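/- A weighted game consists of a finite set of states $S = S_1 \uplus S_2$ ($S_i$ belongs to player $i$), edges $E \subseteq S\times S$ such that every state has a successor, and integer edge weights $w$; let $W$ be the largest absolute weight of an edge. The game is one-player if $S_1=\emptyset$ or $S_2=\emptyset$. A play is an infinite path $\pi=s_0s_1\dots$; its energy level at position $n$ is $\mathrm{EL}_n(\pi)=\sum_{i<n} w(s_i,s_{i+1})$ and its average-energy is $\overline{\mathrm{AE}}(\pi)=\limsup_{n\to\infty}\frac1n\sum_{i=1}^n \mathrm{EL}_i(\pi)\in[-\infty,+\infty]$. For a threshold $t\in\mathbb{Q}$, the $AE_L$ objective (for player 1) is the set of plays $\pi$ with $\mathrm{EL}_n(\pi)\ge 0$ for all $n\ge 0$ and $\overline{\mathrm{AE}}(\pi)\le t$. A strategy of player $i$ maps every finite path ending in $S_i$ to a successor of its last state. A strategy of player 1 (resp. 2) is winning from an initial state $s_0$ if its outcome from $s_0$ against every strategy of the other player belongs to (resp. does not belong to) the objective. A strategy $\sigma$ has memory $k$ if there is a deterministic Moore machine $(M,m_0,\alpha_u,\alpha_n)$ with $|M|=k$, $\alpha_u\colon M\times S\to M$, $\alpha_n\colon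 M\times S_i\to S$, such that $\sigma(\rho\cdot s)=\alpha_n(\hat\alpha_u(m_0,\rho),s)$ for all finite paths $\rho\cdot s$ with $s\in S_i$, where $\hat\alpha_u$ extends $\alpha_u$ to words; it is memoryless if it has memory $1$. Theorem. 1. (Pseudo-polynomial memory suffices for player 1.) There is a polynomial $P$ in three variables with coefficients in $\mathbb{N}$ such that for every one-player game, every initial state and every threshold $t\in\mathbb{Q}$: if player 1 has a winning strategy for the $AE_L$ objective, then he has one with memory at most $P(|S|,W,\max(\lceil t\rceil,0))$. 2. (Pseudo-polynomial memory is necessary for player 1.) For every integer $U\ge 1$ there are a game with $S_2=\emptyset$, $|S|=2$, $W=U$, and an initial state, such that for the threshold $t=U$ player 1 has a winning strategy for the $AE_L$ objective, but each of his winning strategies with memory $k$ satisfies $k\ge U+1$. 3. (Memoryless strategies suffice for player 2.) In every one-player game, for every initial state and every $t\in\mathbb{Q}$: if player 2 has a winning strategy against the $AE_L$ objective, then he has a memoryless one. -/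

import Mathlib

namespace AvgEnergy

/-- The two players. -/
inductive Player where
  | one
  | two

/-- A turn-based weighted game on the finite state set `S`. The states of player `i` are those with
`owner s = i`; `E` is the edge relation, without deadlocks. Only the values of `w` on edges matter. -/
structure WGame (S : Type*) [Fintype S] where
  owner : S → Player
  E : S → S → Prop
  noDeadlock : ∀ s, ∃ s', E s s'
  w : S → S → ℤ

variable {S : Type*} [Fintype S]

namespace WGame

/-- One of the two players owns no state. -/
def IsOnePlayer (G : WGame S) : Prop :=
  (∀ s, G.owner s ≠ Player.one) ∨ (∀ s, G.owner s ≠ Player.two)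

open Classical in
/-- The largest absolute weight of an edge. -/
noncomputable def largestWeight (G : WGame S) : ℕ :=
  ((Finset.univ : Finset (S × S)).filter (fun e => G.E e.1 e.2)).sup (fun e => (G.w e.1 e.2).natAbs)

/-- Plays: infinite paths in the graph. -/
def IsPlay (G : WGame S) (π : ℕ → S) : Prop := ∀ n, G.E (π n) (π (n + 1))

/-- The word `ρ · s` is a finite path of the graph, i.e. a prefix with last state `s`. -/
def IsPrefix (G : WGame S) (ρ : List S) (s : S) : Prop := (ρ ++ [s]).IsChain G.E

/-- Energy level of the prefix of length `n`. -/
def energy (G : WGame S) (π : ℕ → S) (n : ℕ) : ℤ :=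
  ∑ i ∈ Finset.range n, G.w (π i) (π (i + 1))

/-- Average-energy of a play (`limsup` variant), a value in `[-∞, +∞]`. -/
noncomputable def avgEnergySup (G : WGame S) (π : ℕ → S) : EReal :=
  Filter.limsup
    (fun n : ℕ => (((1 / (n : ℝ)) * ∑ i ∈ Finset.Icc 1 n, (G.energy π i : ℝ) : ℝ) : EReal))
    Filter.atTop

/-- Lower-bounded energy objective with initial energy level `c`. -/
def lowerBound (G : WGame S) (c : ℕ) : Set (ℕ → S) :=
  {π | G.IsPlay π ∧ ∀ n, 0 ≤ (c : ℤ) + G.energy π n}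

/-- Average-energy objective with threshold `t`. -/
def avgEnergyAtMost (G : WGame S) (t : ℚ) : Set (ℕ → S) :=
  {π | G.IsPlay π ∧ G.avgEnergySup π ≤ ((t : ℝ) : EReal)}

/-- The objective `AEL`: average-energy at most `t` under lower-bounded energy, with initial
energy level `0`. -/
def ael (G : WGame S) (t : ℚ) : Set (ℕ → S) := G.lowerBound 0 ∩ G.avgEnergyAtMost t

end WGame

/-- Strategies of player `i`: `act ρ s` is the state chosen after the prefix `ρ · s`. Only the values
on prefixes whose last state belongs to player `i` matter. -/
structure Strategy (G : WGame S) (i : Player) where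
  act : List S → S → S
  legal : ∀ ρ s, G.IsPrefix ρ s → G.owner s = i → G.E s (act ρ s)

instance (G : WGame S) (i : Player) : Nonempty (Strategy G i) :=
  ⟨⟨fun _ s => (G.noDeadlock s).choose, fun _ s _ _ => (G.noDeadlock s).choose_spec⟩⟩

/-- The `n`-th prefix (history and current state) of the outcome of two strategies. -/
def trace {G : WGame S} (s₀ : S) (σ₁ : Strategy G Player.one) (σ₂ : Strategy G Player.two) :
    ℕ → List S × S
  | 0 => ([], s₀)
  | n + 1 =>
    let ρ := (trace s₀ σ₁ σ₂ n).1
    let s := (trace s₀ σ₁ σ₂ n).2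
    (ρ ++ [s], match G.owner s with
      | Player.one => σ₁.act ρ s
      | Player.two => σ₂.act ρ s)

/-- The outcome of two strategies from `s₀`. -/
def out {G : WGame S} (s₀ : S) (σ₁ : Strategy G Player.one) (σ₂ : Strategy G Player.two) (n : ℕ) : S :=
  (trace s₀ σ₁ σ₂ n).2

/-- A play is consistent with a strategy of player `i`. -/
def Consistent {G : WGame S} {i : Player} (σ : Strategy G i) (π : ℕ → S) : Prop :=
  ∀ n, G.owner (π n) = i → π (n + 1) = σ.act ((List.range n).map π) (π n)

/-- Player 1 wins the objective `W` from `s₀` with `σ₁`. -/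
def WinsOne {G : WGame S} (s₀ : S) (W : Set (ℕ → S)) (σ₁ : Strategy G Player.one) : Prop :=
  ∀ σ₂ : Strategy G Player.two, out s₀ σ₁ σ₂ ∈ W

/-- Player 2 wins against the objective `W` from `s₀` with `σ₂`. -/
def WinsTwo {G : WGame S} (s₀ : S) (W : Set (ℕ → S)) (σ₂ : Strategy G Player.two) : Prop :=
  ∀ σ₁ : Strategy G Player.one, out s₀ σ₁ σ₂ ∉ W

/-- Deterministic Moore machines with memory `M` reading states. -/
structure MooreMachine (S M : Type*) where
  init : M
  update : M → S → M
  next : M → S → S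

/-- The machine encodes the strategy: `σ(ρ · s) = next (update* init ρ) s`. -/
def MooreMachine.Encodes {G : WGame S} {i : Player} {M : Type*} (A : MooreMachine S M)
    (σ : Strategy G i) : Prop :=
  ∀ ρ s, G.IsPrefix ρ s → G.owner s = i → σ.act ρ s = A.next (ρ.foldl A.update A.init) s

/-- The strategy is encoded by a Moore machine with exactly `k` memory states. -/
def Strategy.HasMemory {G : WGame S} {i : Player} (σ : Strategy G i) (k : ℕ) : Prop :=
  ∃ (M : Type) (_ : Fintype M) (A : MooreMachine S M), Fintype.card M = k ∧ A.Encodes σ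

/-- Memoryless strategies: one memory state. -/
def Strategy.Memoryless {G : WGame S} {i : Player} (σ : Strategy G i) : Prop := σ.HasMemory 1

theorem trace_fst {G : WGame S} (s₀ : S) (σ₁ : Strategy G Player.one)
    (σ₂ : Strategy G Player.two) (n : ℕ) :
    (trace s₀ σ₁ σ₂ n).1 = (List.range n).map (out s₀ σ₁ σ₂) := by
  induction n with
  | zero => rfl
  | succ n ih => simp [trace, List.range_succ, ih, out]

theorem out_succ {G : WGame S} (s₀ : S) (σ₁ : Strategy G Player.one)
    (σ₂ : Strategy G Player.two) (n : ℕ) :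
    out s₀ σ₁ σ₂ (n + 1) = match G.owner (out s₀ σ₁ σ₂ n) with
      | Player.one => σ₁.act ((List.range n).map (out s₀ σ₁ σ₂)) (out s₀ σ₁ σ₂ n)
      | Player.two => σ₂.act ((List.range n).map (out s₀ σ₁ σ₂)) (out s₀ σ₁ σ₂ n) := by
  rw [← trace_fst]; rfl

/-- The outcome is the unique play from `s₀` that is consistent with both strategies. -/
theorem eq_out_iff {G : WGame S} (s₀ : S) (σ₁ : Strategy G Player.one)
    (σ₂ : Strategy G Player.two) (π : ℕ → S) :
    π = out s₀ σ₁ σ₂ ↔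
      G.IsPlay π ∧ π 0 = s₀ ∧ Consistent σ₁ π ∧ Consistent σ₂ π := by
  have key : ∀ n, G.IsPrefix ((List.range n).map (out s₀ σ₁ σ₂)) (out s₀ σ₁ σ₂ n) ∧
      G.E (out s₀ σ₁ σ₂ n) (out s₀ σ₁ σ₂ (n + 1)) := by
    have edge : ∀ n, G.IsPrefix ((List.range n).map (out s₀ σ₁ σ₂)) (out s₀ σ₁ σ₂ n) →
        G.E (out s₀ σ₁ σ₂ n) (out s₀ σ₁ σ₂ (n + 1)) := by
      intro n hp
      rw [out_succ]
      cases ho : G.owner (out s₀ σ₁ σ₂ n) with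
      | one => exact σ₁.legal _ _ hp ho
      | two => exact σ₂.legal _ _ hp ho
    intro n
    induction n with
    | zero =>
      have h0 : G.IsPrefix ((List.range 0).map (out s₀ σ₁ σ₂)) (out s₀ σ₁ σ₂ 0) := by
        simp [WGame.IsPrefix]
      exact ⟨h0, edge 0 h0⟩
    | succ n ih =>
      have h1 : G.IsPrefix ((List.range (n + 1)).map (out s₀ σ₁ σ₂)) (out s₀ σ₁ σ₂ (n + 1)) := by
        have h2 := ih.1
        unfold WGame.IsPrefix at h2 ⊢
        rw [List.range_succ, List.map_append, List.map_singleton, List.isChain_append]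
        refine ⟨h2, by simp, ?_⟩
        intro x hx y hy
        simp at hx hy
        subst hx hy
        exact ih.2
      exact ⟨h1, edge _ h1⟩
  constructor
  · rintro rfl
    refine ⟨fun n => (key n).2, rfl, fun n hn => ?_, fun n hn => ?_⟩
    · rw [out_succ, hn]
    · rw [out_succ, hn]
  · rintro ⟨-, h0, h1, h2⟩
    funext n
    induction n using Nat.strong_induction_on with
    | _ n ih =>
      cases n with
      | zero => exact h0
      | succ n =>
        have hn : π n = out s₀ σ₁ σ₂ n := ih n (Nat.lt_succ_self n)
        have hm : (List.range n).map π = (List.range n).map (out s₀ σ₁ σ₂) := by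
          apply List.map_congr_left
          intro a ha
          exact ih a (by have := List.mem_range.1 ha; omega)
        rw [out_succ, ← hm, ← hn]
        cases ho : G.owner (π n) with
        | one => exact h1 n ho
        | two => exact h2 n ho

end AvgEnergy

/-! In a one-player game a strategy of the lone player amounts to a play, so the task is to find
plays of a special shape. The main tool is the graph of pairs (state, energy level), where leaving a
vertex of level `e` costs `e - τ`. Partial costs bounded below give average-energy at least `τ`;
bounded above, at most `τ`. In a finite graph a walk of very negative cost reveals a reachable cycle
of negative cost (`exists_bound_hasLasso`), and stem and cycle can be chosen without repetitions
(`HasLasso.exists_simple`).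

Player 1: for `τ` slightly above `t`, the partial costs of a winning play are unbounded below. The
graph is infinite, but high excursions can be cut by a pigeonhole on the crossings of successive
levels (`exists_shorter_walk`), so a cheap walk exists among pseudo-polynomially many vertices. It
yields a simple lasso of pseudo-polynomial length. Integrality of the levels (`int_sum_le_of_lt`)
turns "mean below `τ`" into "mean at most `t`", and a counter running along the lasso is all the
memory needed.

Lower bound: in `loopGame`, looping `U` times per round keeps all levels between `0` and `U`. With
at most `U` memory states, `U + 1` consecutive visits to the loop state would repeat a memory state
and so last forever, making the energy negative. Hence each round loops fewer than `U` times, gains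
at least `1`, and the levels tend to infinity.

Player 2: a reachable cycle of nonzero weight gives a violating positional play. Otherwise, along a
walk from `s₀` the state determines the level (`snd_eq_of_not_hasLasso`), so a walk without
repetitions among pairs has none among states. A shortest walk to a negative level, or a simple
lasso of mean above `t`, can then be followed positionally. -/

namespace AvgEnergy

/-! ### Cycles of negative cost in weighted graphs -/

section Graph

variable {V : Type*} {R : V → V → Prop} {f : V → V → ℝ}

/-- `Walk R f x y n c`: there is a walk from `x` to `y` of length `n` and total cost `c`. -/
inductive Walk (R : V → V → Prop) (f : V → V → ℝ) : V → V → ℕ → ℝ → Prop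
  | nil (x : V) : Walk R f x x 0 0
  | cons {x y z : V} {n : ℕ} {c : ℝ} :
      R x y → Walk R f y z n c → Walk R f x z (n + 1) (f x y + c)

theorem Walk.append {x y z : V} {m n : ℕ} {c d : ℝ} (h : Walk R f x y m c)
    (h' : Walk R f y z n d) : Walk R f x z (m + n) (c + d) := by
  induction h with
  | nil x => simpa using h'
  | cons hr _ ih =>
    have := Walk.cons (f := f) hr (ih h')
    rwa [← add_assoc, add_right_comm] at this

theorem Walk.of_seq_add (q : ℕ → V) (a n : ℕ)
    (h : ∀ i, a ≤ i → i < a + n → R (q i) (q (i + 1))) :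
    Walk R f (q a) (q (a + n)) n (∑ i ∈ Finset.Ico a (a + n), f (q i) (q (i + 1))) := by
  induction n with
  | zero => simpa using Walk.nil (q a)
  | succ n ih =>
    have h1 := ih fun i hi hin => h i hi (by omega)
    have h2 : Walk R f (q (a + n)) (q (a + n + 1)) 1 (f (q (a + n)) (q (a + n + 1)) + 0) :=
      Walk.cons (h (a + n) (by omega) (by omega)) (Walk.nil _)
    have h3 := h1.append h2
    rw [← add_assoc, Finset.sum_Ico_succ_top (by omega)]
    simpa using h3

theorem Walk.of_seq (q : ℕ → V) {a b : ℕ} (hab : a ≤ b)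
    (h : ∀ i, a ≤ i → i < b → R (q i) (q (i + 1))) :
    Walk R f (q a) (q b) (b - a) (∑ i ∈ Finset.Ico a b, f (q i) (q (i + 1))) := by
  obtain ⟨n, rfl⟩ := Nat.exists_eq_add_of_le hab
  rw [Nat.add_sub_cancel_left]
  exact Walk.of_seq_add q a n h

theorem Walk.exists_seq {x y : V} {n : ℕ} {c : ℝ} (h : Walk R f x y n c) :
    ∃ q : ℕ → V, q 0 = x ∧ q n = y ∧ (∀ i < n, R (q i) (q (i + 1))) ∧
      ∑ i ∈ Finset.Ico 0 n, f (q i) (q (i + 1)) = c := by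
  induction h with
  | nil x => exact ⟨fun _ => x, rfl, rfl, by simp, by simp⟩
  | @cons x y z n c hr _ ih =>
    obtain ⟨q, h0, hn, hq, hc⟩ := ih
    refine ⟨fun i => Nat.casesOn i x q, rfl, hn, ?_, ?_⟩
    · rintro (_ | i) hi
      · simpa [h0] using hr
      · exact hq i (by omega)
    · rw [← Finset.range_eq_Ico] at hc ⊢
      rw [Finset.sum_range_succ', ← hc, add_comm]
      simp [h0]

theorem sum_Ico_split (g : ℕ → ℝ) {a b c : ℕ} (hab : a ≤ b) (hbc : b ≤ c) :
    ∑ i ∈ Finset.Ico a c, g i = ∑ i ∈ Finset.Ico a b, g i + ∑ i ∈ Finset.Ico b c, g i :=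
  (Finset.sum_Ico_consecutive g hab hbc).symm

/-- A cycle of negative cost is reachable from `x`. -/
def HasLasso (R : V → V → Prop) (f : V → V → ℝ) (x : V) : Prop :=
  ∃ (y : V) (a b : ℕ) (c d : ℝ), Walk R f x y a c ∧ Walk R f y y b d ∧ 0 < b ∧ d < 0

/-- A reachable cycle of negative cost can be chosen such that the stem and the cycle together
visit no vertex twice. -/
theorem HasLasso.exists_simple {x : V} (h : HasLasso R f x) :
    ∃ (q : ℕ → V) (a b : ℕ), 0 < b ∧ q 0 = x ∧ (∀ i < a + b, R (q i) (q (i + 1))) ∧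
      q (a + b) = q a ∧ (∀ i j, i < j → j < a + b → q i ≠ q j) ∧
      ∑ i ∈ Finset.Ico a (a + b), f (q i) (q (i + 1)) < 0 := by
  classical
  -- The total length of stem and cycle is minimised; any repetition would produce a shorter lasso.
  let P : ℕ → Prop := fun n => ∃ (y : V) (a b : ℕ) (c d : ℝ), a + b = n ∧
    Walk R f x y a c ∧ Walk R f y y b d ∧ 0 < b ∧ d < 0
  have hP : ∃ n, P n := by
    obtain ⟨y, a, b, c, d, h1, h2, h3, h4⟩ := h
    exact ⟨_, y, a, b, c, d, rfl, h1, h2, h3, h4⟩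
  have hmin : ∀ (y : V) (a b : ℕ) (c d : ℝ), Walk R f x y a c → Walk R f y y b d → 0 < b →
      d < 0 → Nat.find hP ≤ a + b := fun y a b c d h1 h2 h3 h4 =>
    Nat.find_min' hP ⟨y, a, b, c, d, rfl, h1, h2, h3, h4⟩
  obtain ⟨y, a, b, c, d, hab, h1, h2, hb, hd⟩ := Nat.find_spec hP
  rw [← hab] at hmin
  obtain ⟨p, hp0, hpa, hp, hpc⟩ := h1.exists_seq
  obtain ⟨r, hr0, hrb, hr, hrd⟩ := h2.exists_seq
  let q : ℕ → V := fun i => if i ≤ a then p i else r (i - a)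
  have hql : ∀ i ≤ a, q i = p i := fun i hi => if_pos hi
  have hqr : ∀ i, q (a + i) = r i := by
    intro i
    rcases Nat.eq_zero_or_pos i with rfl | hi
    · rw [add_zero, hql a le_rfl, hpa, hr0]
    · simp [q, show ¬ a + i ≤ a by omega]
  have hq0 : q 0 = x := by rw [hql 0 (Nat.zero_le _), hp0]
  have hqa : q a = y := by rw [hql a le_rfl, hpa]
  have hqab : q (a + b) = y := by rw [hqr, hrb]
  have hqR : ∀ i < a + b, R (q i) (q (i + 1)) := by
    intro i hi
    rcases Nat.lt_or_ge i a with h | h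
    · rw [hql i h.le, hql (i + 1) h]
      exact hp i h
    · obtain ⟨k, rfl⟩ := Nat.exists_eq_add_of_le h
      rw [hqr, add_assoc, hqr]
      exact hr k (by omega)
  have hsum : ∑ i ∈ Finset.Ico a (a + b), f (q i) (q (i + 1)) = d := by
    rw [← hrd, Finset.sum_Ico_eq_sum_range, Nat.add_sub_cancel_left, Finset.range_eq_Ico]
    exact Finset.sum_congr rfl fun i _ => by rw [hqr, add_assoc, hqr]
  refine ⟨q, a, b, hb, hq0, hqR, hqab.trans hqa.symm, ?_, hsum ▸ hd⟩
  intro i j hij hj heq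
  have seg : ∀ {u v : ℕ}, u ≤ v → v ≤ a + b →
      Walk R f (q u) (q v) (v - u) (∑ i ∈ Finset.Ico u v, f (q i) (q (i + 1))) :=
    fun huv hv => Walk.of_seq q huv fun i _ hi => hqR i (by omega)
  have stem := fun {v : ℕ} (hv : v ≤ a + b) => hq0 ▸ seg (Nat.zero_le v) hv
  rcases Nat.lt_or_ge a j with haj | haj
  · rcases Nat.lt_or_ge i a with hia | hia
    · -- the cycle is entered earlier
      have w1 := stem (v := i) (by omega)
      have w2 := (seg (u := j) (v := a + b) (by omega) le_rfl)
      rw [hqab, ← hqa] at w2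
      have w3 := w2.append (seg (u := a) (v := j) haj.le hj.le)
      rw [← heq] at w3
      have hle := hmin _ _ _ _ _ w1 w3 (by omega) (by
        rw [add_comm, ← sum_Ico_split (fun i => f (q i) (q (i + 1))) haj.le hj.le, hsum]
        exact hd)
      omega
    · have s1 := sum_Ico_split (fun i => f (q i) (q (i + 1))) hia (show i ≤ a + b by omega)
      have s2 := sum_Ico_split (fun i => f (q i) (q (i + 1))) hij.le hj.le
      -- A repetition inside the cycle splits it into two closed walks, at least one of which has
      -- negative cost.
      rcases lt_or_ge (∑ k ∈ Finset.Ico i j, f (q k) (q (k + 1))) 0 with hneg | hpos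
      · have w1 := stem (v := i) (by omega)
        have w2 := seg hij.le hj.le
        rw [← heq] at w2
        have hle := hmin _ _ _ _ _ w1 w2 (by omega) hneg
        omega
      · have w1 := stem (v := a) (by omega)
        have w2 := seg hia (by omega)
        have w3 := seg hj.le le_rfl
        rw [← heq, hqab, ← hqa] at w3
        have hle := hmin _ _ _ _ _ w1 (w2.append w3) (by omega) (by linarith)
        omega
  · have w1 := (stem (v := i) (by omega)).append
      (heq ▸ seg (u := j) (v := a) haj (by omega))
    rw [hqa] at w1
    have hle := hmin _ _ _ _ _ w1 h2 hb hd
    omega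

/-- In a finite graph, a walk of very negative cost passes a cycle of negative cost. -/
theorem exists_bound_hasLasso (A : Finset V) (hA : ∀ x y, R x y → x ∈ A ∧ y ∈ A)
    (f : V → V → ℝ) : ∃ K : ℝ, ∀ n x y c, Walk R f x y n c → c < -K → HasLasso R f x := by
  classical
  set B : ℝ := ∑ u ∈ A, ∑ v ∈ A, |f u v| with hB
  have hB0 : 0 ≤ B := Finset.sum_nonneg fun u _ => Finset.sum_nonneg fun v _ => abs_nonneg _
  have hfB : ∀ x y, R x y → -B ≤ f x y := by
    intro x y hxy
    obtain ⟨hx, hy⟩ := hA x y hxy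
    have h1 : |f x y| ≤ ∑ v ∈ A, |f x v| :=
      Finset.single_le_sum (f := fun v => |f x v|) (fun v _ => abs_nonneg _) hy
    have h2 : ∑ v ∈ A, |f x v| ≤ B :=
      Finset.single_le_sum (f := fun u => ∑ v ∈ A, |f u v|)
        (fun u _ => Finset.sum_nonneg fun v _ => abs_nonneg _) hx
    linarith [neg_abs_le (f x y)]
  -- A walk of at most `A.card` steps costs at least `-(A.card * B)`. A longer one repeats a vertex:
  -- the closed part is either negative, or can be removed without raising the cost.
  refine ⟨A.card * B, fun n => ?_⟩
  induction n using Nat.strong_induction_on with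
  | _ n ih =>
  intro x y c hw hc
  obtain ⟨q, h0, hn, hq, hs⟩ := hw.exists_seq
  rcases Nat.lt_or_ge A.card n with hlt | hle
  · have hmem : ∀ i ∈ Finset.range (n + 1), q i ∈ A := by
      intro i hi
      rcases Nat.lt_or_ge i n with h | h
      · exact (hA _ _ (hq i h)).1
      · have : i = n - 1 + 1 := by have := Finset.mem_range.1 hi; omega
        rw [this]
        exact (hA _ _ (hq (n - 1) (by omega))).2
    obtain ⟨i, hi, j, hj, hne, heq⟩ := Finset.exists_ne_map_eq_of_card_lt_of_maps_to
      (by simp; omega) hmem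
    wlog hij : i < j generalizing i j
    · exact this j hj i hi hne.symm heq.symm (by omega)
    have hjn : j ≤ n := by have := Finset.mem_range.1 hj; omega
    have seg : ∀ {u v : ℕ}, u ≤ v → v ≤ n →
        Walk R f (q u) (q v) (v - u) (∑ i ∈ Finset.Ico u v, f (q i) (q (i + 1))) :=
      fun huv hv => Walk.of_seq q huv fun i _ hi => hq i (by omega)
    have w1 := h0 ▸ seg (Nat.zero_le i) (by omega)
    rcases lt_or_ge (∑ k ∈ Finset.Ico i j, f (q k) (q (k + 1))) 0 with hneg | hpos
    · have w2 := seg hij.le hjn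
      rw [← heq] at w2
      exact ⟨q i, _, _, _, _, w1, w2, by omega, hneg⟩
    · have w2 := w1.append (heq ▸ seg hjn le_rfl)
      have s1 := sum_Ico_split (fun i => f (q i) (q (i + 1))) (Nat.zero_le i)
        (show i ≤ n by omega)
      have s2 := sum_Ico_split (fun i => f (q i) (q (i + 1))) hij.le hjn
      exact ih _ (by omega) _ _ _ w2 (by linarith)
  · exfalso
    have h1 : ∑ i ∈ Finset.Ico 0 n, (-B) ≤ ∑ i ∈ Finset.Ico 0 n, f (q i) (q (i + 1)) :=
      Finset.sum_le_sum fun i hi => hfB _ _ (hq i (Finset.mem_Ico.1 hi).2)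
    rw [hs] at h1
    simp at h1
    have h2 : (n : ℝ) * B ≤ A.card * B := by gcongr
    linarith

theorem Walk.mono {R' : V → V → Prop} (hR : ∀ x y, R x y → R' x y) {x y : V} {n : ℕ} {c : ℝ}
    (h : Walk R f x y n c) : Walk R' f x y n c := by
  induction h with
  | nil x => exact Walk.nil x
  | cons hr _ ih => exact Walk.cons (hR _ _ hr) ih

theorem HasLasso.mono {R' : V → V → Prop} (hR : ∀ x y, R x y → R' x y) {x : V}
    (h : HasLasso R f x) : HasLasso R' f x := by
  obtain ⟨y, a, b, c, d, h1, h2, h3, h4⟩ := h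
  exact ⟨y, a, b, c, d, h1.mono hR, h2.mono hR, h3, h4⟩

end Graph

/-! ### Cutting high excursions in the graph of states and levels -/

theorem exists_last_before {P : ℕ → Prop} {j : ℕ} (h0 : P 0) (hj : ¬ P j) :
    ∃ i < j, P i ∧ ∀ m, i < m → m ≤ j → ¬ P m := by
  induction j with
  | zero => exact absurd h0 hj
  | succ j ih =>
    by_cases h : P j
    · refine ⟨j, by omega, h, fun m h1 h2 => ?_⟩
      rwa [show m = j + 1 by omega]
    · obtain ⟨i, hi, hPi, hm⟩ := ih h
      refine ⟨i, by omega, hPi, fun m h1 h2 => ?_⟩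
      rcases Nat.lt_or_ge m (j + 1) with h3 | h3
      · exact hm m h1 (by omega)
      · rwa [show m = j + 1 by omega]

theorem exists_first_after {P : ℕ → Prop} {j n : ℕ} (hjn : j ≤ n) (hn : P n) (hj : ¬ P j) :
    ∃ k, j < k ∧ k ≤ n ∧ P k ∧ ∀ m, j ≤ m → m < k → ¬ P m := by
  classical
  have hex : ∃ k, j ≤ k ∧ P k := ⟨n, hjn, hn⟩
  have hs := Nat.find_spec hex
  refine ⟨Nat.find hex, ?_, Nat.find_min' hex ⟨hjn, hn⟩, hs.2, ?_⟩
  · rcases hs.1.lt_or_eq with h | h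
    · exact h
    · exact absurd (h ▸ hs.2) hj
  · exact fun m h1 h2 h3 => Nat.find_min hex h2 ⟨h1, h3⟩

section Expanded

variable {S : Type*} [Fintype S]

/-- The graph of states and energy levels. -/
def WGame.Step (G : WGame S) (x y : S × ℤ) : Prop :=
  G.E x.1 y.1 ∧ y.2 = x.2 + G.w x.1 y.1

/-- The graph of states and energy levels, restricted to levels between `0` and `U`. -/
def WGame.StepIn (G : WGame S) (U : WithTop ℤ) (x y : S × ℤ) : Prop :=
  G.Step x y ∧ 0 ≤ x.2 ∧ 0 ≤ y.2 ∧ (x.2 : WithTop ℤ) ≤ U ∧ (y.2 : WithTop ℤ) ≤ U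

/-- The cost of leaving a vertex at level `e` is `e - τ`. -/
def excess (τ : ℝ) (x _y : S × ℤ) : ℝ := x.2 - τ

/-- Excursions to high energy levels can be cut down without increasing the cost. -/
theorem exists_shorter_walk (G : WGame S) (W H : ℕ) (hW : ∀ s s', G.E s s' → |G.w s s'| ≤ W)
    {τ : ℝ} (hτ : τ ≤ H) {x y : S × ℤ} {n : ℕ} {c : ℝ} (hx : x.2 ≤ H) (hy : y.2 ≤ H)
    (q : ℕ → S × ℤ) (hq0 : q 0 = x) (hqn : q n = y)
    (hq : ∀ i < n, G.StepIn ⊤ (q i) (q (i + 1)))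
    (hc : ∑ i ∈ Finset.Ico 0 n, excess τ (q i) (q (i + 1)) = c)
    {j : ℕ} (hjn : j ≤ n)
    (hj : ((H + W + Fintype.card S ^ 2 * W ^ 2 : ℕ) : ℤ) < (q j).2) :
    ∃ n' c', n' < n ∧ c' ≤ c ∧ Walk (G.StepIn ⊤) (excess τ) x y n' c' := by
  classical
  set D := Fintype.card S ^ 2 * W ^ 2 with hD
  -- The `D + 1` levels lie below the peak at `j`. For each, `u k` is the last time before the peak
  -- and `v k` the first time after it at which the walk is not above the level. A step changes the
  -- level by at most `W`, so these points lie less than `W` below it; the summand `W` keeps them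
  -- above `H`.
  let lev : ℕ → ℤ := fun k => H + W + k
  have up : ∀ k : ℕ, k ∈ Finset.range (D + 1) →
      ∃ i < j, (q i).2 ≤ lev k ∧ (∀ m, i < m → m ≤ j → lev k < (q m).2) ∧
        lev k - (q i).2 < W := by
    intro k hk
    have hk' : k ≤ D := by have := Finset.mem_range.1 hk; omega
    obtain ⟨i, hi, h1, h2⟩ := exists_last_before (P := fun m => (q m).2 ≤ lev k) (j := j)
      (by simp only [hq0, lev]; omega) (by simp only [lev]; push_cast at hj ⊢; omega)
    refine ⟨i, hi, h1, fun m h3 h4 => not_le.1 (h2 m h3 h4), ?_⟩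
    have h5 := h2 (i + 1) (by omega) (by omega)
    have h6 := (hq i (by omega)).1
    have h7 := abs_le.1 (hW _ _ h6.1)
    have h8 := h6.2
    omega
  have down : ∀ k : ℕ, k ∈ Finset.range (D + 1) →
      ∃ i, j < i ∧ i ≤ n ∧ (q i).2 ≤ lev k ∧ (∀ m, j ≤ m → m < i → lev k < (q m).2) ∧
        lev k - (q i).2 < W := by
    intro k hk
    have hk' : k ≤ D := by have := Finset.mem_range.1 hk; omega
    obtain ⟨i, hi, hin, h1, h2⟩ := exists_first_after (P := fun m => (q m).2 ≤ lev k) hjn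
      (by simp only [hqn, lev]; omega) (by simp only [lev]; push_cast at hj ⊢; omega)
    refine ⟨i, hi, hin, h1, fun m h3 h4 => not_le.1 (h2 m h3 h4), ?_⟩
    have h5 := h2 (i - 1) (by omega) (by omega)
    have h6 := (hq (i - 1) (by omega)).1
    rw [Nat.sub_add_cancel (by omega)] at h6
    have h7 := abs_le.1 (hW _ _ h6.1)
    have h8 := h6.2
    omega
  choose! u hu1 hu2 hu3 hu4 using up
  choose! v hv1 hv2 hv3 hv4 hv5 using down
  -- Each level is labelled by state and offset at both crossings. There are only `D` labels, so two
  -- levels share one.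
  let T : Finset ((S × ℤ) × (S × ℤ)) :=
    (Finset.univ ×ˢ Finset.Ico 0 (W : ℤ)) ×ˢ (Finset.univ ×ˢ Finset.Ico 0 (W : ℤ))
  let F : ℕ → (S × ℤ) × (S × ℤ) := fun k =>
    (((q (u k)).1, lev k - (q (u k)).2), ((q (v k)).1, lev k - (q (v k)).2))
  have hT : T.card = D := by
    simp [T, hD]; ring
  have hF : ∀ k ∈ Finset.range (D + 1), F k ∈ T := by
    intro k hk
    simp only [F, T, Finset.mem_product, Finset.mem_univ, true_and, Finset.mem_Ico]
    have := hu2 k hk; have := hu4 k hk; have := hv3 k hk; have := hv5 k hk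
    omega
  obtain ⟨k, hk, l, hl, hne, hkl⟩ := Finset.exists_ne_map_eq_of_card_lt_of_maps_to
    (by simp [hT]) hF
  wlog hlt : k < l generalizing k l
  · exact this l hl k hk hne.symm hkl.symm (by omega)
  simp only [F, Prod.mk.injEq] at hkl
  obtain ⟨⟨e1, e2⟩, e3, e4⟩ := hkl
  have hlev : lev l - lev k = (l : ℤ) - k := by simp only [lev]; ring
  have huu : u k < u l := by
    rcases lt_trichotomy (u k) (u l) with h | h | h
    · exact h
    · rw [h] at e2; omega
    · have := hu3 l hl (u k) h (hu1 k hk).le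
      have := hu2 k hk
      omega
  have hvv : v l < v k := by
    rcases lt_trichotomy (v l) (v k) with h | h | h
    · exact h
    · rw [h] at e4; omega
    · have := hv4 l hl (v k) (hv1 k hk).le h
      have := hv3 k hk
      omega
  have huj := hu1 l hl
  have hvj := hv1 l hl
  have hvn := hv2 k hk
  let d : ℤ := (l : ℤ) - k
  -- The part of the excursion above the upper level, moved down by `d`, fits exactly between the
  -- crossings of the lower level.
  let r : ℕ → S × ℤ := fun i => ((q i).1, (q i).2 - d)
  have hru : r (u l) = q (u k) := Prod.ext e1.symm (by simp only [r, d]; omega)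
  have hrv : r (v l) = q (v k) := Prod.ext e3.symm (by simp only [r, d]; omega)
  have hlevk : (H : ℤ) + W ≤ lev k := by simp only [lev]; omega
  have hnn : ∀ i ≤ n, 0 ≤ (q i).2 := by
    intro i hi
    rcases Nat.lt_or_ge i n with h | h
    · exact (hq i h).2.1
    · obtain rfl : i = n - 1 + 1 := by omega
      exact (hq (n - 1) (by omega)).2.2.1
  have hr0 : ∀ i, u l ≤ i → i ≤ v l → 0 ≤ (r i).2 := by
    intro i h1 h2
    rcases h1.eq_or_lt with rfl | h1
    · rw [hru]; exact hnn _ (by omega)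
    rcases h2.eq_or_lt with rfl | h2
    · rw [hrv]; exact hnn _ (by omega)
    have : lev l < (q i).2 := by
      rcases le_total i j with h | h
      · exact hu3 l hl i h1 h
      · exact hv4 l hl i h h2
    simp only [r, d]
    omega
  have w1 := Walk.of_seq (R := G.StepIn ⊤) (f := excess τ) q (Nat.zero_le (u k))
    fun i _ hi => hq i (by omega)
  have w2 := Walk.of_seq (R := G.StepIn ⊤) (f := excess τ) r (show u l ≤ v l by omega)
    fun i hi1 hi2 => by
      have h := (hq i (by omega)).1
      refine ⟨⟨h.1, ?_⟩, hr0 i hi1 hi2.le, hr0 (i + 1) (by omega) (by omega), le_top, le_top⟩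
      have := h.2
      simp only [r]
      omega
  have w3 := Walk.of_seq (R := G.StepIn ⊤) (f := excess τ) q hvn
    fun i _ hi => hq i (by omega)
  rw [hru, hrv] at w2
  rw [hq0] at w1
  rw [hqn] at w3
  refine ⟨_, _, ?_, ?_, (w1.append w2).append w3⟩
  · omega
  · let g := fun i => excess τ (q i) (q (i + 1))
    -- The two removed pieces stay at levels at least `H ≥ τ`, hence cost at least `0`; moving the
    -- middle piece down only lowers its cost.
    have s1 := sum_Ico_split g (Nat.zero_le (u k)) (show u k ≤ n by omega)
    have s2 := sum_Ico_split g huu.le (show u l ≤ n by omega)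
    have s3 := sum_Ico_split g (show u l ≤ v l by omega) (show v l ≤ n by omega)
    have s4 := sum_Ico_split g hvv.le hvn
    have p1 : 0 ≤ ∑ i ∈ Finset.Ico (u k) (u l), g i := by
      refine Finset.sum_nonneg fun i hi => ?_
      have hi := Finset.mem_Ico.1 hi
      have h1 : (H : ℤ) ≤ (q i).2 := by
        rcases hi.1.eq_or_lt with rfl | h
        · have := hu4 k hk; omega
        · have := hu3 k hk i h (by omega); omega
      have h2 : ((H : ℤ) : ℝ) ≤ (q i).2 := by exact_mod_cast h1
      simp only [g, excess]
      push_cast at h2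
      linarith
    have p2 : 0 ≤ ∑ i ∈ Finset.Ico (v l) (v k), g i := by
      refine Finset.sum_nonneg fun i hi => ?_
      have hi := Finset.mem_Ico.1 hi
      have h1 : (H : ℤ) ≤ (q i).2 := by
        have := hv4 k hk i (by omega) hi.2; omega
      have h2 : ((H : ℤ) : ℝ) ≤ (q i).2 := by exact_mod_cast h1
      simp only [g, excess]
      push_cast at h2
      linarith
    have p3 : ∑ i ∈ Finset.Ico (u l) (v l), excess τ (r i) (r (i + 1)) ≤
        ∑ i ∈ Finset.Ico (u l) (v l), g i := by
      refine Finset.sum_le_sum fun i _ => ?_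
      have h1 : (r i).2 ≤ (q i).2 := by simp only [r, d]; omega
      have h2 : ((r i).2 : ℝ) ≤ (q i).2 := by exact_mod_cast h1
      simp only [g, excess]
      linarith
    simp only [g] at s1 s2 s3 s4 p1 p2 p3
    rw [← hc]
    linarith

/-- A walk between low levels can be replaced by one that stays below a pseudo-polynomial level,
without increasing the cost. -/
theorem exists_bounded_walk (G : WGame S) (W H : ℕ) (hW : ∀ s s', G.E s s' → |G.w s s'| ≤ W)
    {τ : ℝ} (hτ : τ ≤ H) {x y : S × ℤ} (hx : x.2 ≤ H) (hy : y.2 ≤ H) (n : ℕ) (c : ℝ)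
    (hw : Walk (G.StepIn ⊤) (excess τ) x y n c) :
    ∃ n' c', c' ≤ c ∧ Walk
      (G.StepIn (((H + W + Fintype.card S ^ 2 * W ^ 2 : ℕ) : ℤ) : WithTop ℤ))
      (excess τ) x y n' c' := by
  induction n using Nat.strong_induction_on generalizing c with
  | _ n ih =>
  obtain ⟨q, hq0, hqn, hq, hc⟩ := hw.exists_seq
  by_cases hb : ∃ j ≤ n, ((H + W + Fintype.card S ^ 2 * W ^ 2 : ℕ) : ℤ) < (q j).2
  · obtain ⟨j, hjn, hj⟩ := hb
    obtain ⟨n', c', hn', hc', hw'⟩ := exists_shorter_walk G W H hW hτ hx hy q hq0 hqn hq hc hjn hj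
    obtain ⟨n'', c'', h1, h2⟩ := ih n' hn' c' hw'
    exact ⟨n'', c'', h1.trans hc', h2⟩
  · push Not at hb
    refine ⟨n, c, le_rfl, ?_⟩
    have := Walk.of_seq (f := excess τ)
      (R := G.StepIn (((H + W + Fintype.card S ^ 2 * W ^ 2 : ℕ) : ℤ) : WithTop ℤ))
      q (Nat.zero_le n) fun i _ hi => by
        obtain ⟨h1, h2, h3, -, -⟩ := hq i hi
        exact ⟨h1, h2, h3, WithTop.coe_le_coe.2 (hb i hi.le), WithTop.coe_le_coe.2 (hb _ hi)⟩
    rwa [hq0, hqn, hc] at this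

end Expanded

/-! ### Average-energy and eventually periodic plays -/

theorem neg_le_sum_range_of_periodic {h : ℕ → ℝ} {a b : ℕ} (hb : 0 < b)
    (hp : ∀ i, a ≤ i → h (i + b) = h i) (hs : 0 ≤ ∑ i ∈ Finset.Ico a (a + b), h i) :
    ∃ C, ∀ n, -C ≤ ∑ i ∈ Finset.range n, h i := by
  have shift : ∀ k, ∑ i ∈ Finset.range (a + k + b), h i = ∑ i ∈ Finset.range (a + k), h i +
      ∑ i ∈ Finset.Ico a (a + b), h i := by
    intro k
    induction k with
    | zero =>
      simp only [Finset.range_eq_Ico, add_zero]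
      exact sum_Ico_split h (Nat.zero_le a) (by omega)
    | succ k ih =>
      rw [show a + (k + 1) + b = a + k + b + 1 by omega, Finset.sum_range_succ, ih,
        hp _ (by omega), ← add_assoc, Finset.sum_range_succ]
      ring
  refine ⟨∑ i ∈ Finset.range (a + b), |h i|, fun n => ?_⟩
  -- Dropping a full period does not increase a partial sum, so the sums with fewer than `a + b`
  -- terms decide.
  induction n using Nat.strong_induction_on with
  | _ n ih =>
  rcases Nat.lt_or_ge n (a + b) with hn | hn
  · have h1 : ∑ i ∈ Finset.range n, |h i| ≤ ∑ i ∈ Finset.range (a + b), |h i| :=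
      Finset.sum_le_sum_of_subset_of_nonneg (Finset.range_mono hn.le) fun _ _ _ => abs_nonneg _
    have h2 := (abs_le.1 (Finset.abs_sum_le_sum_abs h (Finset.range n))).1
    linarith
  · obtain ⟨k, rfl⟩ := Nat.exists_eq_add_of_le hn
    have h1 := ih (a + k) (by omega)
    rw [show a + b + k = a + k + b by omega, shift]
    linarith

variable {S : Type*} [Fintype S] {G : WGame S}

namespace WGame

theorem energy_succ (π : ℕ → S) (n : ℕ) :
    G.energy π (n + 1) = G.energy π n + G.w (π n) (π (n + 1)) :=
  Finset.sum_range_succ _ n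

theorem energy_zero (π : ℕ → S) : G.energy π 0 = 0 := rfl

/-- The vertices of a walk are counted from position `0`, the average-energy from position `1`. The
two agree because the initial energy is `0`, at the price of `n + 1` copies of `τ`. -/
theorem sum_Icc_energy (π : ℕ → S) (τ : ℝ) (n : ℕ) :
    ∑ i ∈ Finset.Icc 1 n, (G.energy π i : ℝ) =
      ∑ i ∈ Finset.range (n + 1), ((G.energy π i : ℝ) - τ) + (n + 1) * τ := by
  induction n with
  | zero => simp [energy_zero]
  | succ n ih =>
    rw [Finset.sum_Icc_succ_top (by omega), ih, Finset.sum_range_succ _ (n + 1)]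
    push_cast
    ring

theorem tendsto_const_add_div (τ C : ℝ) :
    Filter.Tendsto (fun n : ℕ => ((τ + C / n : ℝ) : EReal)) Filter.atTop
      (nhds (τ : EReal)) := by
  have h := (tendsto_const_div_atTop_nhds_zero_nat C).const_add τ
  rw [add_zero] at h
  exact EReal.tendsto_coe.2 h

/-- The averages are at least `τ` plus a constant over `n`, which tends to `τ`. -/
theorem le_avgEnergySup {π : ℕ → S} {τ C : ℝ}
    (h : ∀ n, -C ≤ ∑ i ∈ Finset.range n, ((G.energy π i : ℝ) - τ)) :
    (τ : EReal) ≤ G.avgEnergySup π := by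
  rw [← (tendsto_const_add_div τ (τ - C)).limsup_eq]
  refine Filter.limsup_le_limsup ?_
  filter_upwards [Filter.eventually_gt_atTop 0] with n hn
  have hn' : (0 : ℝ) < n := by exact_mod_cast hn
  have h1 := h (n + 1)
  rw [EReal.coe_le_coe_iff, sum_Icc_energy π τ, one_div, ← div_eq_inv_mul, le_div_iff₀ hn',
    add_mul, div_mul_cancel₀ _ hn'.ne']
  linarith

theorem avgEnergySup_le {π : ℕ → S} {τ C : ℝ}
    (h : ∀ n, ∑ i ∈ Finset.range n, ((G.energy π i : ℝ) - τ) ≤ C) :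
    G.avgEnergySup π ≤ (τ : EReal) := by
  rw [← (tendsto_const_add_div τ (τ + C)).limsup_eq]
  refine Filter.limsup_le_limsup ?_
  filter_upwards [Filter.eventually_gt_atTop 0] with n hn
  have hn' : (0 : ℝ) < n := by exact_mod_cast hn
  have h1 := h (n + 1)
  rw [EReal.coe_le_coe_iff, sum_Icc_energy π τ, one_div, ← div_eq_inv_mul, div_le_iff₀ hn',
    add_mul τ, div_mul_cancel₀ _ hn'.ne']
  linarith

theorem le_avgEnergySup_of_forall_ge {π : ℕ → S} {τ : ℝ} {N : ℕ}
    (h : ∀ n, N ≤ n → τ ≤ G.energy π n) : (τ : EReal) ≤ G.avgEnergySup π := by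
  refine le_avgEnergySup (C := ∑ i ∈ Finset.range N, |(G.energy π i : ℝ) - τ|) fun n => ?_
  induction n with
  | zero =>
    simp only [Finset.range_zero, Finset.sum_empty, neg_nonpos]
    exact Finset.sum_nonneg fun _ _ => abs_nonneg _
  | succ n ih =>
    rcases Nat.lt_or_ge n N with hn | hn
    · have h1 : ∑ i ∈ Finset.range (n + 1), |(G.energy π i : ℝ) - τ| ≤
          ∑ i ∈ Finset.range N, |(G.energy π i : ℝ) - τ| :=
        Finset.sum_le_sum_of_subset_of_nonneg (Finset.range_mono hn) fun _ _ _ => abs_nonneg _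
      have h2 := (abs_le.1 (Finset.abs_sum_le_sum_abs
        (fun i => (G.energy π i : ℝ) - τ) (Finset.range (n + 1)))).1
      linarith
    · rw [Finset.sum_range_succ]
      have := h n hn
      linarith

theorem energy_add_period {p : ℕ → S} {a b : ℕ} (hp : ∀ n, a ≤ n → p (n + b) = p n) {n : ℕ}
    (hn : a ≤ n) :
    G.energy p (n + b) = G.energy p n + (G.energy p (a + b) - G.energy p a) := by
  induction n, hn using Nat.le_induction with
  | base => ring
  | succ n hn ih =>
    rw [show n + 1 + b = n + b + 1 by omega, energy_succ, ih, energy_succ, hp n hn,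
      show n + b + 1 = n + 1 + b by omega, hp (n + 1) (by omega)]
    ring

theorem energy_add_mul_period {p : ℕ → S} {a b : ℕ} (hp : ∀ n, a ≤ n → p (n + b) = p n) {n : ℕ}
    (hn : a ≤ n) (k : ℕ) :
    G.energy p (n + k * b) = G.energy p n + k * (G.energy p (a + b) - G.energy p a) := by
  induction k with
  | zero => simp
  | succ k ih =>
    rw [show n + (k + 1) * b = n + k * b + b by ring, energy_add_period hp (by omega), ih]
    push_cast
    ring

theorem energy_eq_of_step {q : ℕ → S × ℤ} {p : ℕ → S} {N : ℕ} (h0 : (q 0).2 = 0)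
    (hq : ∀ i < N, G.Step (q i) (q (i + 1))) (hp : ∀ i ≤ N, p i = (q i).1) {i : ℕ} (hi : i ≤ N) :
    G.energy p i = (q i).2 := by
  induction i with
  | zero => rw [energy_zero, h0]
  | succ i ih =>
    rw [energy_succ, ih (by omega), hp i (by omega), hp (i + 1) hi, (hq i hi).2]

theorem step_of_isPlay {π : ℕ → S} (h : G.IsPlay π) (i : ℕ) :
    G.Step (π i, G.energy π i) (π (i + 1), G.energy π (i + 1)) :=
  ⟨h i, energy_succ π i⟩

theorem abs_w_le (G : WGame S) {s s' : S} (h : G.E s s') : |G.w s s'| ≤ (G.largestWeight : ℤ) := by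
  classical
  rw [Int.abs_eq_natAbs]
  exact_mod_cast Finset.le_sup (f := fun e : S × S => (G.w e.1 e.2).natAbs)
    (Finset.mem_filter.2 ⟨Finset.mem_univ (s, s'), h⟩)

end WGame

/-! ### Strategies of a lone player -/

/-- A machine all of whose moves are legal is a strategy. -/
def MooreMachine.strategy {M : Type*} (A : MooreMachine S M) (i : Player)
    (hA : ∀ m s, G.E s (A.next m s)) : Strategy G i where
  act ρ s := A.next (ρ.foldl A.update A.init) s
  legal _ _ _ _ := hA _ _

open Classical in
/-- The machine whose memory evolves independently of the states it reads, and that plays `g m` in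
memory state `m` whenever this is a legal move. -/
noncomputable def counterMachine (G : WGame S) {M : Type*} (m₀ : M) (u : M → M) (g : M → S) :
    MooreMachine S M where
  init := m₀
  update m _ := u m
  next m s := if G.E s (g m) then g m else (G.noDeadlock s).choose

theorem counterMachine_legal (G : WGame S) {M : Type*} (m₀ : M) (u : M → M) (g : M → S) (m : M)
    (s : S) : G.E s ((counterMachine G m₀ u g).next m s) := by
  unfold counterMachine
  dsimp only
  split_ifs with h
  · exact h
  · exact (G.noDeadlock s).choose_spec

theorem foldl_const_update {M A : Type*} (u : M → M) (ρ : List A) (m : M) :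
    ρ.foldl (fun m _ => u m) m = u^[ρ.length] m := by
  induction ρ generalizing m with
  | nil => rfl
  | cons s ρ ih => simp [ih]

/-- Player 1, if alone, follows a play by a machine that computes its states. -/
theorem winsOne_counterMachine (hown : ∀ s, G.owner s ≠ Player.two) {M : Type*} (m₀ : M)
    (u : M → M) (g : M → S) {π : ℕ → S} (hπ : G.IsPlay π) (hg : ∀ n, π (n + 1) = g (u^[n] m₀))
    {W : Set (ℕ → S)} (hW : π ∈ W) :
    WinsOne (π 0) W ((counterMachine G m₀ u g).strategy (G := G) Player.one
      (counterMachine_legal G m₀ u g)) := by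
  intro σ₂
  convert hW
  refine ((eq_out_iff _ _ _ _).2 ⟨hπ, rfl, fun n _ => ?_, fun n hn => absurd hn (hown _)⟩).symm
  have h1 : ((List.range n).map π).foldl (counterMachine G m₀ u g).update
      (counterMachine G m₀ u g).init = u^[n] m₀ := by
    have := foldl_const_update u ((List.range n).map π) m₀
    rwa [List.length_map, List.length_range] at this
  have h2 := hπ n
  rw [hg n] at h2 ⊢
  change _ = (counterMachine G m₀ u g).next _ _
  rw [h1]
  simp [counterMachine, h2]

theorem out_isPlay (s₀ : S) (σ₁ : Strategy G Player.one) (σ₂ : Strategy G Player.two) :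
    G.IsPlay (out s₀ σ₁ σ₂) :=
  ((eq_out_iff s₀ σ₁ σ₂ _).1 rfl).1

/-- Memoryless strategies. -/
def positional (i : Player) (g : S → S) (hg : ∀ s, G.E s (g s)) : Strategy G i where
  act _ s := g s
  legal _ s _ _ := hg s

theorem positional_memoryless (i : Player) (g : S → S) (hg : ∀ s, G.E s (g s)) :
    (positional i g hg : Strategy G i).Memoryless :=
  ⟨Unit, inferInstance, ⟨(), fun _ _ => (), fun _ s => g s⟩, rfl, fun _ _ _ _ => rfl⟩

theorem exists_memoryless (G : WGame S) (i : Player) : ∃ σ : Strategy G i, σ.Memoryless :=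
  ⟨_, positional_memoryless i (fun s => (G.noDeadlock s).choose)
    fun s => (G.noDeadlock s).choose_spec⟩

/-- If player 1 owns no state, his strategy does not matter. -/
theorem out_eq_of_ne_one (hown : ∀ s, G.owner s ≠ Player.one) (s₀ : S)
    (σ₁ σ₁' : Strategy G Player.one) (σ₂ : Strategy G Player.two) :
    out s₀ σ₁ σ₂ = out s₀ σ₁' σ₂ := by
  obtain ⟨h1, h2, -, h4⟩ := (eq_out_iff s₀ σ₁ σ₂ _).1 rfl
  exact (eq_out_iff _ _ _ _).2 ⟨h1, h2, fun n hn => absurd hn (hown _), h4⟩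

/-- If player 2 owns no state, his strategy does not matter. -/
theorem out_eq_of_ne_two (hown : ∀ s, G.owner s ≠ Player.two) (s₀ : S)
    (σ₁ : Strategy G Player.one) (σ₂ σ₂' : Strategy G Player.two) :
    out s₀ σ₁ σ₂ = out s₀ σ₁ σ₂' := by
  obtain ⟨h1, h2, h3, -⟩ := (eq_out_iff s₀ σ₁ σ₂ _).1 rfl
  exact (eq_out_iff _ _ _ _).2 ⟨h1, h2, h3, fun n hn => absurd hn (hown _)⟩

/-! ### Player 1 alone: short lassos -/

/-- A winning play yields a walk of arbitrarily small cost that ends at a low level. -/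
theorem exists_cheap_walk {s₀ : S} {t : ℚ} {π : ℕ → S} (h0 : π 0 = s₀) (hπ : π ∈ G.ael t) {τ : ℝ}
    (htτ : (t : ℝ) < τ) {H : ℕ} (hτ : τ ≤ H) (K : ℝ) :
    ∃ y n c, y.2 ≤ (H : ℤ) ∧ Walk (G.StepIn ⊤) (excess τ) (s₀, 0) y n c ∧ c < -K := by
  obtain ⟨⟨hplay, hnn⟩, -, havg⟩ := hπ
  simp only [Nat.cast_zero, zero_add] at hnn
  -- The slack `|τ|` pays for cutting the walk back to its last low position `m`: among the removed
  -- terms only that of `m` can be negative, and it is at least `-τ`.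
  obtain ⟨n, hn⟩ : ∃ n, ∑ i ∈ Finset.range n, ((G.energy π i : ℝ) - τ) < -(K + |τ|) := by
    by_contra! hcon
    have := (WGame.le_avgEnergySup hcon).trans havg
    rw [EReal.coe_le_coe_iff] at this
    linarith
  have key : ∃ m, G.energy π m ≤ (H : ℤ) ∧
      ∑ i ∈ Finset.range m, ((G.energy π i : ℝ) - τ) < -K := by
    by_cases hPn : G.energy π n ≤ (H : ℤ)
    · exact ⟨n, hPn, by linarith [abs_nonneg τ]⟩
    · obtain ⟨m, hmn, hm, hlast⟩ := exists_last_before (P := fun m => G.energy π m ≤ (H : ℤ))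
        (by simp [WGame.energy_zero]) hPn
      refine ⟨m, hm, ?_⟩
      have h1 := Finset.sum_range_add_sum_Ico (fun i => (G.energy π i : ℝ) - τ) hmn
      rw [Finset.sum_range_succ] at h1
      have h2 : 0 ≤ ∑ i ∈ Finset.Ico (m + 1) n, ((G.energy π i : ℝ) - τ) := by
        refine Finset.sum_nonneg fun i hi => ?_
        have hi := Finset.mem_Ico.1 hi
        have h3 := not_le.1 (hlast i hi.1 hi.2.le)
        have h4 : ((H : ℤ) : ℝ) < G.energy π i := by exact_mod_cast h3
        push_cast at h4
        linarith
      have h5 : (0 : ℝ) ≤ G.energy π m := by exact_mod_cast hnn m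
      linarith [le_abs_self τ]
  obtain ⟨m, hm, hc⟩ := key
  have hw := Walk.of_seq (R := G.StepIn ⊤) (f := excess τ) (fun i => (π i, G.energy π i))
    (Nat.zero_le m) fun i _ _ => ⟨WGame.step_of_isPlay hplay i, hnn i, hnn _, le_top, le_top⟩
  rw [Finset.range_eq_Ico] at hc
  refine ⟨(π m, G.energy π m), m, _, hm, ?_, hc⟩
  simp only [h0, WGame.energy_zero, Nat.sub_zero] at hw
  exact hw

/-- The number `X - b * t` is a multiple of `1 / t.den`, and the hypothesis places it below `b /
(t.den * N) ≤ 1 / t.den`. -/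
theorem int_sum_le_of_lt {t : ℚ} {X : ℤ} {b : ℕ} {N : ℕ} (hN : 0 < N) (hb : b ≤ N)
    (h : (X : ℝ) - b * (t + 1 / (t.den * N)) < 0) : (X : ℝ) - b * t ≤ 0 := by
  have hd : (0 : ℝ) < t.den := by exact_mod_cast t.den_pos
  have hN' : (0 : ℝ) < N := by exact_mod_cast hN
  have hb' : (b : ℝ) ≤ N := by exact_mod_cast hb
  have ht : (t : ℝ) = t.num / t.den := Rat.cast_def t
  have h1 : (b : ℝ) * (1 / (t.den * N)) ≤ 1 / t.den := by
    rw [mul_one_div, div_le_div_iff₀ (by positivity) hd]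
    nlinarith
  have h2 : (X : ℝ) * t.den - b * t.num < 1 := by
    have h3 : (X : ℝ) - b * t < 1 / t.den := by linarith
    rw [lt_div_iff₀ hd, ht] at h3
    have : (X - b * (t.num / t.den : ℝ)) * t.den = X * t.den - b * t.num := by
      field_simp
    linarith
  have h3 : X * t.den - b * t.num < 1 := by exact_mod_cast h2
  have h4 : X * t.den - b * t.num ≤ 0 := by omega
  have h5 : (X : ℝ) * t.den - b * t.num ≤ 0 := by exact_mod_cast h4
  have h6 : (X : ℝ) - b * t = (X * t.den - b * t.num) / t.den := by
    rw [ht]; field_simp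
  rw [h6]
  exact div_nonpos_of_nonpos_of_nonneg h5 hd.le

/-- The bound on the energy level of an optimal play. -/
def levelBound (n W T : ℕ) : ℕ := (T + 1) + W + n ^ 2 * W ^ 2

theorem exists_short_lasso {s₀ : S} {t : ℚ} {π : ℕ → S} (h0 : π 0 = s₀) (hπ : π ∈ G.ael t) :
    ∃ (q : ℕ → S × ℤ) (a b : ℕ), 0 < b ∧ q 0 = (s₀, 0) ∧
      (∀ i < a + b, G.Step (q i) (q (i + 1)) ∧ 0 ≤ (q i).2) ∧ q (a + b) = q a ∧
      a + b ≤ Fintype.card S * (levelBound (Fintype.card S) G.largestWeight ⌈t⌉₊ + 1) ∧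
      ∑ i ∈ Finset.Ico a (a + b), (((q i).2 : ℝ) - t) ≤ 0 := by
  classical
  set U := levelBound (Fintype.card S) G.largestWeight ⌈t⌉₊
  set N := Fintype.card S * (U + 1) with hN
  have hNpos : 0 < N := Nat.mul_pos (Fintype.card_pos_iff.2 ⟨s₀⟩) (Nat.succ_pos _)
  -- Strictly above `t`, so that the costs are unbounded below; close enough to `t` for
  -- `int_sum_le_of_lt` on cycles of length at most `N`; at most `t + 1`, whence the low level `⌈t⌉₊
  -- + 1`.
  set τ : ℝ := t + 1 / (t.den * N) with hτ
  have hd : (1 : ℝ) ≤ t.den := by exact_mod_cast t.den_pos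
  have hN1 : (1 : ℝ) ≤ N := by exact_mod_cast hNpos
  have hδ : (0 : ℝ) < 1 / (t.den * N) := by positivity
  have hδ1 : 1 / (t.den * N : ℝ) ≤ 1 := by
    rw [div_le_one (by positivity)]
    nlinarith
  have hceil : (t : ℝ) ≤ (⌈t⌉₊ : ℝ) := by exact_mod_cast Nat.le_ceil t
  have hτH : τ ≤ (⌈t⌉₊ + 1 : ℕ) := by push_cast; linarith
  let A : Finset (S × ℤ) := Finset.univ ×ˢ Finset.Icc 0 (U : ℤ)
  have hAcard : A.card = N := by simp [A, hN]
  have hA : ∀ x y, G.StepIn ((U : ℤ) : WithTop ℤ) x y → x ∈ A ∧ y ∈ A := by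
    rintro x y ⟨-, h1, h2, h3, h4⟩
    have h3 := WithTop.coe_le_coe.1 h3
    have h4 := WithTop.coe_le_coe.1 h4
    simp only [A, Finset.mem_product, Finset.mem_univ, Finset.mem_Icc, true_and]
    exact ⟨⟨h1, h3⟩, h2, h4⟩
  -- The constant `K` depends only on the bounded graph, so it can be fixed before the cheap walk is
  -- chosen in the unbounded one.
  obtain ⟨K, hK⟩ := exists_bound_hasLasso A hA (excess τ)
  obtain ⟨y, n, c, hy, hw, hc⟩ := exists_cheap_walk h0 hπ (τ := τ) (by linarith) hτH K
  obtain ⟨n', c', hc', hw'⟩ := exists_bounded_walk G G.largestWeight (⌈t⌉₊ + 1)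
    (fun s s' h => G.abs_w_le h) hτH (x := (s₀, 0)) (by positivity) hy n c hw
  obtain ⟨q, a, b, hb, hq0, hq, hab, hinj, hs⟩ :=
    (hK _ _ _ _ hw' (hc'.trans_lt hc)).exists_simple
  have hle : a + b ≤ N := by
    rw [← hAcard, ← Finset.card_range (a + b)]
    refine Finset.card_le_card_of_injOn q (fun i hi => (hA _ _ (hq i ?_)).1) ?_
    · simpa using hi
    · intro i hi j hj hij
      simp only [Finset.coe_range, Set.mem_Iio] at hi hj
      rcases lt_trichotomy i j with h | h | h
      · exact absurd hij (hinj i j h hj)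
      · exact h
      · exact absurd hij.symm (hinj j i h hi)
  refine ⟨q, a, b, hb, hq0, fun i hi => ⟨(hq i hi).1, (hq i hi).2.1⟩, hab, hle, ?_⟩
  have := int_sum_le_of_lt (t := t) (X := ∑ i ∈ Finset.Ico a (a + b), (q i).2) (b := b) hNpos
    (by omega) (by
      simp only [excess, Finset.sum_sub_distrib, Finset.sum_const, Nat.card_Ico,
        Nat.add_sub_cancel_left, nsmul_eq_mul] at hs
      push_cast
      exact hs)
  simp only [Finset.sum_sub_distrib, Finset.sum_const, Nat.card_Ico,
        Nat.add_sub_cancel_left, nsmul_eq_mul]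
  push_cast at this
  exact this

/-- Counting along a stem of length `a` and then around a cycle of length `b`. -/
def lassoNext (a b : ℕ) (hb : 0 < b) (m : Fin (a + b)) : Fin (a + b) :=
  if h : (m : ℕ) + 1 < a + b then ⟨m + 1, h⟩ else ⟨a, by omega⟩

theorem lassoNext_iterate_of_lt {a b : ℕ} (hb : 0 < b) {n : ℕ} (hn : n < a + b) :
    (((lassoNext a b hb)^[n] ⟨0, by omega⟩ : Fin (a + b)) : ℕ) = n := by
  induction n with
  | zero => rfl
  | succ n ih =>
    rw [Function.iterate_succ_apply', lassoNext, dif_pos (by rw [ih (by omega)]; exact hn)]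
    simp [ih (by omega : n < a + b)]

theorem lassoNext_iterate_period {a b : ℕ} (hb : 0 < b) {n : ℕ} (hn : a ≤ n) :
    (lassoNext a b hb)^[n + b] ⟨0, by omega⟩ = (lassoNext a b hb)^[n] ⟨0, by omega⟩ := by
  induction n, hn using Nat.le_induction with
  | base =>
    have h1 := lassoNext_iterate_of_lt (a := a) hb (n := a + b - 1) (by omega)
    apply Fin.ext
    rw [lassoNext_iterate_of_lt hb (show a < a + b by omega)]
    have h2 : ∀ k, k = a + b - 1 + 1 →
        (((lassoNext a b hb)^[k] ⟨0, by omega⟩ : Fin (a + b)) : ℕ) = a := by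
      rintro _ rfl
      rw [Function.iterate_succ_apply', lassoNext, dif_neg (by omega)]
    exact h2 _ (by omega)
  | succ n hn ih =>
    rw [show n + 1 + b = n + b + 1 by omega, Function.iterate_succ_apply', ih,
      Function.iterate_succ_apply']

theorem seq_lassoNext {V : Type*} {q : ℕ → V} {a b : ℕ} (hb : 0 < b) (hq : q (a + b) = q a)
    (m : Fin (a + b)) : q (lassoNext a b hb m) = q (m + 1) := by
  unfold lassoNext
  split_ifs with h
  · rfl
  · have := m.2
    rw [show (m : ℕ) + 1 = a + b by omega, hq]

/-- If player 1 plays alone and some play is winning, then he wins with pseudo-polynomial memory. -/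
theorem exists_winsOne_hasMemory (hown : ∀ s, G.owner s ≠ Player.two) {s₀ : S} {t : ℚ}
    {π : ℕ → S} (h0 : π 0 = s₀) (hπ : π ∈ G.ael t) :
    ∃ σ : Strategy G Player.one, WinsOne s₀ (G.ael t) σ ∧ ∃ k,
      k ≤ Fintype.card S * (levelBound (Fintype.card S) G.largestWeight ⌈t⌉₊ + 1) ∧
      σ.HasMemory k := by
  obtain ⟨q, a, b, hb, hq0, hq, hab, hle, hs⟩ := exists_short_lasso h0 hπ
  let u := lassoNext a b hb
  let m₀ : Fin (a + b) := ⟨0, by omega⟩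
  let p : ℕ → S := fun n => (q (u^[n] m₀)).1
  have hstep : ∀ n, G.Step (q (u^[n] m₀)) (q (u^[n + 1] m₀)) := by
    intro n
    rw [Function.iterate_succ_apply', seq_lassoNext hb hab]
    exact (hq _ (Fin.is_lt _)).1
  have hplay : G.IsPlay p := fun n => (hstep n).1
  have hen : ∀ n, G.energy p n = (q (u^[n] m₀)).2 := fun n =>
    WGame.energy_eq_of_step (q := fun n => q (u^[n] m₀)) (N := n) (by simp [m₀, hq0])
      (fun i _ => hstep i) (fun _ _ => rfl) le_rfl
  have hper : ∀ n, a ≤ n → G.energy p (n + b) = G.energy p n := by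
    intro n hn
    rw [hen, hen, lassoNext_iterate_period hb hn]
  have hmem : p ∈ G.ael t := by
    refine ⟨⟨hplay, fun n => ?_⟩, hplay, ?_⟩
    · rw [hen]
      have := (hq _ (u^[n] m₀).2).2
      simpa using this
    -- The lower bound is applied to the negated costs, to bound the partial costs from above.
    · obtain ⟨C, hC⟩ := neg_le_sum_range_of_periodic (h := fun i => -((G.energy p i : ℝ) - t)) hb
        (fun i hi => by rw [hper i hi]) (by
          have h1 : ∑ i ∈ Finset.Ico a (a + b), -((G.energy p i : ℝ) - t) =
              ∑ i ∈ Finset.Ico a (a + b), -(((q i).2 : ℝ) - t) :=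
            Finset.sum_congr rfl fun i hi => by
              rw [hen, lassoNext_iterate_of_lt hb (Finset.mem_Ico.1 hi).2]
          rw [h1, Finset.sum_neg_distrib]
          linarith)
      refine WGame.avgEnergySup_le (C := C) fun n => ?_
      have := hC n
      rw [Finset.sum_neg_distrib] at this
      linarith
  have hwin := winsOne_counterMachine hown m₀ u (fun m => (q ((m : ℕ) + 1)).1) hplay
    (fun n => by
      simp only [p]
      rw [Function.iterate_succ_apply', seq_lassoNext hb hab]) hmem
  have hp0 : p 0 = s₀ := by simp [p, m₀, hq0]
  rw [hp0] at hwin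
  exact ⟨_, hwin, a + b, hle, Fin (a + b), inferInstance,
    counterMachine G m₀ u fun m => (q ((m : ℕ) + 1)).1, Fintype.card_fin _,
    fun _ _ _ _ => rfl⟩

theorem hasMemory_pseudopolynomial :
    ∃ P : MvPolynomial (Fin 3) ℕ,
      ∀ (S : Type*) [Fintype S] (G : WGame S), G.IsOnePlayer → ∀ (s₀ : S) (t : ℚ),
        (∃ σ : Strategy G Player.one, WinsOne s₀ (G.ael t) σ) →
        ∃ σ : Strategy G Player.one, WinsOne s₀ (G.ael t) σ ∧
          ∃ k : ℕ, k ≤ MvPolynomial.eval ![Fintype.card S, G.largestWeight, ⌈t⌉₊] P ∧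
            σ.HasMemory k := by
  refine ⟨.X 0 * (((.X 2 + 1) + .X 1 + .X 0 ^ 2 * .X 1 ^ 2) + 1), ?_⟩
  intro S _ G hG s₀ t ⟨σ, hσ⟩
  have hP : MvPolynomial.eval ![Fintype.card S, G.largestWeight, ⌈t⌉₊]
      (.X 0 * (((.X 2 + 1) + .X 1 + .X 0 ^ 2 * .X 1 ^ 2) + 1) : MvPolynomial (Fin 3) ℕ) =
      Fintype.card S * (levelBound (Fintype.card S) G.largestWeight ⌈t⌉₊ + 1) := by
    simp [levelBound]
  rw [hP]
  rcases hG with hG | hG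
  -- Player 1 has no choices here, so any strategy wins if one does.
  · obtain ⟨σ', hσ'⟩ := exists_memoryless G Player.one
    refine ⟨σ', fun σ₂ => out_eq_of_ne_one hG s₀ σ σ' σ₂ ▸ hσ σ₂, 1, ?_, hσ'⟩
    exact Nat.mul_pos (Fintype.card_pos_iff.2 ⟨s₀⟩) (Nat.succ_pos _)
  · exact exists_winsOne_hasMemory hG (π := out s₀ σ (Classical.arbitrary _)) rfl (hσ _)

/-! ### A game in which player 1 needs memory -/

section LoopGame

/-- From the first state one gains `U` and moves to the second state, where one can loop at the
price of `1` or return for free. -/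
def loopGame (U : ℕ) : WGame Bool where
  owner _ := Player.one
  E x y := x = true ∨ y = true
  noDeadlock _ := ⟨true, Or.inr rfl⟩
  w x y := if x = false then U else if y = true then -1 else 0

theorem loopGame_largestWeight {U : ℕ} (hU : 1 ≤ U) : (loopGame U).largestWeight = U := by
  classical
  apply le_antisymm
  · refine Finset.sup_le fun e _ => ?_
    simp only [loopGame]
    split_ifs <;> simp [hU]
  · exact Finset.le_sup (f := fun e : Bool × Bool => ((loopGame U).w e.1 e.2).natAbs)
      (b := (false, true)) (Finset.mem_filter.2 ⟨Finset.mem_univ _, Or.inr rfl⟩)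

/-- The position in the cycle that loops `U` times in the second state. -/
def loopCount (U r : ℕ) : ℕ := if r = U + 1 then 0 else r + 1

theorem loopCount_iterate_le (U n : ℕ) : (loopCount U)^[n] 0 ≤ U + 1 := by
  induction n with
  | zero => simp
  | succ n ih =>
    rw [Function.iterate_succ_apply', loopCount]
    split_ifs <;> omega

theorem loopGame_exists_winsOne (U : ℕ) :
    ∃ σ : Strategy (loopGame U) Player.one,
      WinsOne false ((loopGame U).ael (U : ℚ)) σ := by
  let u := loopCount U
  let π : ℕ → Bool := fun n => decide (u^[n] 0 ≠ 0)
  have hle : ∀ n, u^[n] 0 ≤ U + 1 := loopCount_iterate_le U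
  have hplay : (loopGame U).IsPlay π := by
    intro n
    simp only [loopGame, π, decide_eq_true_eq]
    by_cases h : u^[n] 0 = 0
    · right
      rw [Function.iterate_succ_apply', h]
      simp [u, loopCount]
    · exact Or.inl h
  have hen : ∀ n, (loopGame U).energy π n =
      if u^[n] 0 = 0 then 0 else (U : ℤ) + 1 - (u^[n] 0 : ℕ) := by
    intro n
    induction n with
    | zero => simp [WGame.energy_zero]
    | succ n ih =>
      rw [WGame.energy_succ, ih]
      simp only [π, loopGame, Function.iterate_succ_apply']
      have := hle n
      generalize u^[n] 0 = r at this ⊢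
      simp only [u, loopCount]
      by_cases h0 : r = 0
      · simp [h0]
      · by_cases h1 : r = U + 1
        · simp [h1]
        · simp [h0, h1]
          ring
  have hmem : π ∈ (loopGame U).ael (U : ℚ) := by
    refine ⟨⟨hplay, fun n => ?_⟩, hplay, ?_⟩
    · rw [hen]
      have := hle n
      split_ifs <;> omega
    · refine WGame.avgEnergySup_le (C := 0) fun n => Finset.sum_nonpos fun i _ => ?_
      have h1 : (loopGame U).energy π i ≤ U := by
        rw [hen]
        split_ifs <;> omega
      have h2 : ((loopGame U).energy π i : ℝ) ≤ ((U : ℤ) : ℝ) := by exact_mod_cast h1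
      push_cast at h2 ⊢
      linarith
  exact ⟨_, winsOne_counterMachine (fun _ => by simp [loopGame]) 0 u
    (fun m => decide (u m ≠ 0)) hplay
    (fun n => by simp only [π, Function.iterate_succ_apply']) hmem⟩

theorem memory_outcome {S : Type*} [Fintype S] {G : WGame S} {M : Type*} {A : MooreMachine S M}
    {σ : Strategy G Player.one} (hA : A.Encodes σ) (hown : ∀ s, G.owner s = Player.one) (s₀ : S)
    (σ₂ : Strategy G Player.two) :
    ∃ m : ℕ → M, (∀ n, m (n + 1) = A.update (m n) (out s₀ σ σ₂ n)) ∧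
      ∀ n, out s₀ σ σ₂ (n + 1) = A.next (m n) (out s₀ σ σ₂ n) := by
  refine ⟨fun n => ((List.range n).map (out s₀ σ σ₂)).foldl A.update A.init, fun n => ?_,
    fun n => ?_⟩
  · simp [List.range_succ]
  · rw [out_succ, hown]
    refine hA _ _ ?_ (hown _)
    have := out_isPlay s₀ σ σ₂
    unfold WGame.IsPrefix
    rw [← List.map_singleton, ← List.map_append, ← List.range_succ, List.isChain_iff_getElem]
    intro i hi
    simpa using this i

theorem loopGame_memory {U : ℕ} (σ : Strategy (loopGame U) Player.one)
    (hσ : WinsOne false ((loopGame U).ael (U : ℚ)) σ) {k : ℕ} (hk : σ.HasMemory k) :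
    U + 1 ≤ k := by
  classical
  by_contra! hlt
  obtain ⟨M, _, A, hcard, hA⟩ := hk
  obtain ⟨m, hm1, hm2⟩ := memory_outcome hA (fun _ => rfl) false (Classical.arbitrary _)
  obtain ⟨⟨hplay, hnn⟩, -, havg⟩ := hσ (Classical.arbitrary _)
  have h0 : out false σ (Classical.arbitrary _) 0 = false := rfl
  generalize out false σ (Classical.arbitrary _) = π at *
  simp only [Nat.cast_zero, zero_add] at hnn
  have hw : ∀ n, (loopGame U).energy π (n + 1) = (loopGame U).energy π n +
      if π n = false then (U : ℤ) else if π (n + 1) = true then -1 else 0 := fun n =>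
    WGame.energy_succ π n
  -- the second state is not visited `U + 1` times in a row
  have hrun : ∀ n, ¬ ∀ i, n ≤ i → i ≤ n + U → π i = true := by
    intro n hn
    -- At most `U` memory states serve `U + 1` positions. Equal memory at equal states makes the run
    -- periodic, so the loop is never left and the energy drops below `0`.
    obtain ⟨i, hi, j, hj, hne, hij⟩ := Finset.exists_ne_map_eq_of_card_lt_of_maps_to
      (s := Finset.Icc n (n + U)) (t := (Finset.univ : Finset M)) (f := m)
      (by simp [hcard]; omega) (fun _ _ => Finset.mem_univ _)
    wlog hlt : i < j generalizing i j
    · exact this j hj i hi hne.symm hij.symm (by omega)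
    rw [Finset.mem_Icc] at hi hj
    obtain ⟨d, rfl⟩ := Nat.exists_eq_add_of_lt hlt
    have hper : ∀ r, m (i + r + (d + 1)) = m (i + r) ∧ π (i + r + (d + 1)) = π (i + r) := by
      intro r
      induction r with
      | zero => exact ⟨hij.symm, (hn _ (by omega) (by omega)).trans
          (hn _ (by omega) (by omega)).symm⟩
      | succ r ih =>
        rw [show i + (r + 1) + (d + 1) = i + r + (d + 1) + 1 by omega,
          show i + (r + 1) = i + r + 1 by omega, hm1, hm1, hm2, hm2, ih.1, ih.2]
        exact ⟨rfl, rfl⟩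
    have htrue : ∀ r, π (i + r) = true := by
      intro r
      induction r using Nat.strong_induction_on with
      | _ r ih =>
      rcases Nat.lt_or_ge r (d + 1) with h | h
      · exact hn _ (by omega) (by omega)
      · have h1 := (hper (r - (d + 1))).2
        rw [ih _ (by omega), show i + (r - (d + 1)) + (d + 1) = i + r by omega] at h1
        exact h1
    have hdesc : ∀ r : ℕ, (loopGame U).energy π (i + r) = (loopGame U).energy π i - r := by
      intro r
      induction r with
      | zero => simp
      | succ r ih =>
        have h1 := htrue (r + 1)
        rw [← add_assoc] at h1
        rw [← add_assoc, hw, ih, htrue r, h1]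
        push_cast
        simp
        ring
    have h1 := hdesc (((loopGame U).energy π i).toNat + 1)
    have h2 := hnn (i + (((loopGame U).energy π i).toNat + 1))
    have h3 := hnn i
    rw [h1] at h2
    push_cast at h2
    rw [Int.toNat_of_nonneg h3] at h2
    omega
  -- Here `n - r` is the start of the current round, and the bracket on the right is the energy at
  -- that time. A round takes at most `U + 1` steps and gains at least `1`.
  have hinv : ∀ n, ∃ r ≤ n, π (n - r) = false ∧ (∀ i, n - r < i → i ≤ n → π i = true) ∧ r ≤ U ∧
      (n : ℤ) - r ≤ (U + 1) * ((loopGame U).energy π n - if r = 0 then 0 else (U : ℤ) + 1 - r) := by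
    intro n
    induction n with
    | zero => exact ⟨0, le_rfl, h0, by omega, by omega, by simp [WGame.energy_zero]⟩
    | succ n ih =>
      obtain ⟨r, hrn, hr, hri, hrU, hle⟩ := ih
      cases hπ : π (n + 1) with
      | false =>
        refine ⟨0, by omega, hπ, by omega, by omega, ?_⟩
        have hr0 : r ≠ 0 := by
          rintro rfl
          have := hplay n
          simp only [Nat.sub_zero] at hr
          simp [loopGame, hr, hπ] at this
        rw [if_neg hr0] at hle
        rw [hw, hri n (by omega) le_rfl, hπ]
        simp only [Bool.true_eq_false, Bool.false_eq_true, if_false, if_true]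
        push_cast
        have : (r : ℤ) ≤ U := by exact_mod_cast hrU
        nlinarith
      | true =>
        have hrun' : r + 1 ≤ U := by
          by_contra! hcon
          refine hrun (n + 1 - r) fun i h1 h2 => ?_
          rcases Nat.lt_or_ge n i with h | h
          · rwa [show i = n + 1 by omega]
          · exact hri i (by omega) h
        refine ⟨r + 1, by omega, by rwa [show n + 1 - (r + 1) = n - r by omega],
          fun i h1 h2 => ?_, hrun', ?_⟩
        · rcases Nat.lt_or_ge n i with h | h
          · rwa [show i = n + 1 by omega]
          · exact hri i (by omega) h
        · rw [hw, hπ]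
          rcases Nat.eq_zero_or_pos r with rfl | hpos
          · simp only [Nat.sub_zero] at hr
            rw [hr]
            simp only [if_true, Nat.zero_add, Nat.one_ne_zero, if_false] at hle ⊢
            push_cast at hle ⊢
            linarith
          · rw [hri n (by omega) le_rfl]
            rw [if_neg (by omega)] at hle
            simp only [Bool.true_eq_false, if_false, if_true, Nat.succ_ne_zero]
            push_cast
            linarith
  have hlow : ∀ n : ℕ, (n : ℤ) ≤ (U + 1) * (loopGame U).energy π n := by
    intro n
    obtain ⟨r, -, -, -, hrU, hle⟩ := hinv n
    have : (r : ℤ) ≤ U := by exact_mod_cast hrU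
    split_ifs at hle with h
    · subst h; simpa using hle
    · nlinarith
  have hcon := (WGame.le_avgEnergySup_of_forall_ge (G := loopGame U) (π := π) (τ := (U : ℝ) + 1)
    (N := (U + 1) * (U + 1)) fun n hn => by
      have h1 := hlow n
      have h2 : (((U + 1) * (U + 1) : ℕ) : ℤ) ≤ n := by exact_mod_cast hn
      have h3 : (U : ℤ) + 1 ≤ (loopGame U).energy π n := by
        push_cast at h2
        nlinarith
      exact_mod_cast h3).trans havg
  rw [EReal.coe_le_coe_iff] at hcon
  push_cast at hcon
  linarith

theorem memory_necessary (U : ℕ) (hU : 1 ≤ U) :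
    ∃ (S : Type) (_ : Fintype S) (G : WGame S) (s₀ : S),
      (∀ s, G.owner s = Player.one) ∧ Fintype.card S = 2 ∧ G.largestWeight = U ∧
      (∃ σ : Strategy G Player.one, WinsOne s₀ (G.ael (U : ℚ)) σ) ∧
      ∀ σ : Strategy G Player.one,
        WinsOne s₀ (G.ael (U : ℚ)) σ → ∀ k : ℕ, σ.HasMemory k → U + 1 ≤ k :=
  ⟨Bool, inferInstance, loopGame U, false, fun _ => rfl, rfl, loopGame_largestWeight hU,
    loopGame_exists_winsOne U, fun σ hσ _ hk => loopGame_memory σ hσ hk⟩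

end LoopGame

/-! ### Player 2 alone: positional violations -/

/-- A path without repetitions is followed by a choice of one successor for each state. -/
theorem exists_successor_of_injective {q : ℕ → S} {n : ℕ} (hq : ∀ i < n, G.E (q i) (q (i + 1)))
    (hinj : ∀ i j, i < j → j < n → q i ≠ q j) :
    ∃ g : S → S, (∀ s, G.E s (g s)) ∧ ∀ i ≤ n, g^[i] (q 0) = q i := by
  classical
  -- The index is unique, since `q` is injective below `n`. The end `q n` may be an earlier state,
  -- which is how a lasso closes.
  let g : S → S := fun s => if h : ∃ i < n, q i = s then q (h.choose + 1)
    else (G.noDeadlock s).choose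
  have hg : ∀ i < n, g (q i) = q (i + 1) := by
    intro i hi
    have h : ∃ j < n, q j = q i := ⟨i, hi, rfl⟩
    have h1 := h.choose_spec
    have h2 : h.choose = i := by
      rcases lt_trichotomy h.choose i with h3 | h3 | h3
      · exact absurd h1.2 (hinj _ _ h3 hi)
      · exact h3
      · exact absurd h1.2.symm (hinj _ _ h3 h1.1)
    simp only [g, dif_pos h]
    rw [h2]
  refine ⟨g, fun s => ?_, fun i hi => ?_⟩
  · by_cases h : ∃ i < n, q i = s
    · obtain ⟨i, hi, rfl⟩ := h
      rw [hg i hi]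
      exact hq i hi
    · simp only [g, dif_neg h]
      exact (G.noDeadlock s).choose_spec
  · induction i with
    | zero => rfl
    | succ i ih => rw [Function.iterate_succ_apply', ih (by omega), hg i (by omega)]

theorem iterate_add_period {V : Type*} {g : V → V} {x : V} {a b : ℕ}
    (h : g^[a + b] x = g^[a] x) {n : ℕ} (hn : a ≤ n) : g^[n + b] x = g^[n] x := by
  induction n, hn using Nat.le_induction with
  | base => exact h
  | succ n hn ih =>
    rw [show n + 1 + b = n + b + 1 by omega, Function.iterate_succ_apply', ih,
      Function.iterate_succ_apply']

/-- The weights, multiplied by `z`, as a cost function. -/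
def WGame.scaledWeight (G : WGame S) (z : ℤ) (s s' : S) : ℝ := z * G.w s s'

/-- Weights are differences of consecutive levels, so their sum telescopes. -/
theorem Walk.project (z : ℤ) {f : S × ℤ → S × ℤ → ℝ} {x y : S × ℤ} {n : ℕ} {c : ℝ}
    (h : Walk G.Step f x y n c) :
    Walk G.E (G.scaledWeight z) x.1 y.1 n (z * (y.2 - x.2)) := by
  induction h with
  | nil x => simpa using Walk.nil x.1
  | @cons x y v n c hr _ ih =>
    have := Walk.cons (f := G.scaledWeight z) hr.1 ih
    convert this using 1
    have h2 : (y.2 : ℝ) = x.2 + G.w x.1 y.1 := by exact_mod_cast hr.2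
    rw [h2, WGame.scaledWeight]
    ring

/-- A reachable cycle whose weight has a given sign yields a positional play that ends in such a
cycle. -/
theorem exists_successor_of_hasLasso {z : ℤ} {s₀ : S}
    (h : HasLasso G.E (G.scaledWeight z) s₀) :
    ∃ g : S → S, (∀ s, G.E s (g s)) ∧ ∃ a b, (∀ n, a ≤ n → g^[n + b] s₀ = g^[n] s₀) ∧
      z * (G.energy (fun n => g^[n] s₀) (a + b) - G.energy (fun n => g^[n] s₀) a) < 0 := by
  obtain ⟨q, a, b, -, rfl, hq, hab, hinj, hs⟩ := h.exists_simple
  obtain ⟨g, hg, hgq⟩ := exists_successor_of_injective hq hinj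
  refine ⟨g, hg, a, b, fun n => iterate_add_period ?_, ?_⟩
  · rw [hgq _ le_rfl, hgq _ (by omega), hab]
  · have h1 : G.energy (fun n => g^[n] (q 0)) (a + b) - G.energy (fun n => g^[n] (q 0)) a =
        ∑ i ∈ Finset.Ico a (a + b), G.w (q i) (q (i + 1)) := by
      unfold WGame.energy
      rw [sub_eq_iff_eq_add', ← Finset.sum_range_add_sum_Ico _ (Nat.le_add_right a b)]
      congr 1
      refine Finset.sum_congr rfl fun i hi => ?_
      have hi := Finset.mem_Ico.1 hi
      dsimp only
      rw [hgq i (by omega), hgq (i + 1) (by omega)]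
    rw [h1]
    simp only [WGame.scaledWeight, ← Finset.mul_sum] at hs
    exact_mod_cast hs

/-- Each turn loses at least `1`, so one turn more than the level at `a` leads below `0`. -/
theorem notMem_ael_of_negative_cycle {p : ℕ → S} {a b : ℕ} (t : ℚ)
    (hp : ∀ n, a ≤ n → p (n + b) = p n) (h : G.energy p (a + b) - G.energy p a < 0) :
    p ∉ G.ael t := by
  rintro ⟨⟨-, hnn⟩, -⟩
  have h1 := hnn (a + ((G.energy p a).toNat + 1) * b)
  have h2 := hnn a
  simp only [Nat.cast_zero, zero_add] at h1 h2
  rw [WGame.energy_add_mul_period hp le_rfl] at h1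
  push_cast at h1
  rw [Int.toNat_of_nonneg h2] at h1
  nlinarith

/-- Each turn gains at least `1`; if no level is negative, all levels are at least `t + 1` after `⌈t
+ 1⌉₊` turns. -/
theorem notMem_ael_of_positive_cycle {p : ℕ → S} {a b : ℕ} (t : ℚ)
    (hp : ∀ n, a ≤ n → p (n + b) = p n) (h : 0 < G.energy p (a + b) - G.energy p a) :
    p ∉ G.ael t := by
  rintro ⟨⟨-, hnn⟩, -, havg⟩
  simp only [Nat.cast_zero, zero_add] at hnn
  have hN := Nat.le_ceil ((t : ℝ) + 1)
  set X := ⌈(t : ℝ) + 1⌉₊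
  have := (WGame.le_avgEnergySup_of_forall_ge (G := G) (π := p) (τ := (t : ℝ) + 1)
    (N := a + X * b) fun n hn => by
      obtain ⟨r, rfl⟩ := Nat.exists_eq_add_of_le hn
      rw [show a + X * b + r = a + r + X * b by ring,
        WGame.energy_add_mul_period hp (by omega)]
      have h1 := hnn (a + r)
      have h2 : (X : ℤ) ≤ G.energy p (a + r) + X * (G.energy p (a + b) - G.energy p a) := by
        nlinarith
      have h3 : ((X : ℤ) : ℝ) ≤ ((G.energy p (a + r) + X * (G.energy p (a + b) - G.energy p a)
        : ℤ) : ℝ) := by exact_mod_cast h2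
      exact hN.trans (by simpa using h3)).trans havg
  rw [EReal.coe_le_coe_iff] at this
  linarith

/-- Returning to a state at another level would close a reachable cycle of nonzero weight, which the
two hypotheses exclude, one for each sign. -/
theorem snd_eq_of_not_hasLasso {s₀ : S} (h1 : ¬ HasLasso G.E (G.scaledWeight 1) s₀)
    (h2 : ¬ HasLasso G.E (G.scaledWeight (-1)) s₀) {q : ℕ → S × ℤ} {n : ℕ} (h0 : q 0 = (s₀, 0))
    (hq : ∀ i < n, G.Step (q i) (q (i + 1))) {i j : ℕ} (hij : i < j) (hj : j ≤ n)
    (heq : (q i).1 = (q j).1) : q i = q j := by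
  have w1 := Walk.of_seq (R := G.Step) (f := fun _ _ => 0) q (Nat.zero_le i)
    fun k _ hk => hq k (by omega)
  have w2 := Walk.of_seq (R := G.Step) (f := fun _ _ => 0) q hij.le
    fun k _ hk => hq k (by omega)
  rw [h0] at w1
  have key : ∀ z : ℤ, ¬ HasLasso G.E (G.scaledWeight z) s₀ →
      0 ≤ (z : ℝ) * ((q j).2 - (q i).2) := by
    intro z hz
    by_contra! hneg
    have w3 := w2.project z
    rw [← heq] at w3
    exact hz ⟨_, _, _, _, _, w1.project z, w3, by omega, hneg⟩
  have k1 := key 1 h1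
  have k2 := key (-1) h2
  push_cast at k1 k2
  have h3 : ((q i).2 : ℝ) = (q j).2 := by linarith
  exact Prod.ext heq (by exact_mod_cast h3)

/-- A shortest walk to a negative level repeats no state before its end: the level would repeat too,
and the part in between could be cut out. -/
theorem exists_successor_of_negative {s₀ : S} (h1 : ¬ HasLasso G.E (G.scaledWeight 1) s₀)
    (h2 : ¬ HasLasso G.E (G.scaledWeight (-1)) s₀) {π : ℕ → S} (h0 : π 0 = s₀)
    (hπ : G.IsPlay π) {N : ℕ} (hN : G.energy π N < 0) (t : ℚ) :
    ∃ g : S → S, (∀ s, G.E s (g s)) ∧ (fun n => g^[n] s₀) ∉ G.ael t := by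
  classical
  have hex : ∃ n, ∃ (y : S × ℤ) (c : ℝ),
      Walk G.Step (fun _ _ => 0) (s₀, 0) y n c ∧ y.2 < 0 := by
    have hw := Walk.of_seq (R := G.Step) (f := fun _ _ => 0) (fun i => (π i, G.energy π i))
      (Nat.zero_le N) fun i _ _ => WGame.step_of_isPlay hπ i
    simp only [h0, WGame.energy_zero] at hw
    exact ⟨_, _, _, hw, hN⟩
  obtain ⟨y, c, hw, hy⟩ := Nat.find_spec hex
  have hmin : ∀ n (y : S × ℤ) c, Walk G.Step (fun _ _ => 0) (s₀, 0) y n c → y.2 < 0 →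
      Nat.find hex ≤ n := fun n y c h h' => Nat.find_min' hex ⟨y, c, h, h'⟩
  set n := Nat.find hex
  obtain ⟨q, hq0, hqn, hq, -⟩ := hw.exists_seq
  have hinj : ∀ i j, i < j → j < n → (q i).1 ≠ (q j).1 := by
    intro i j hij hj heq
    have h3 := snd_eq_of_not_hasLasso h1 h2 hq0 hq hij hj.le heq
    have w1 := Walk.of_seq (R := G.Step) (f := fun _ _ => 0) q (Nat.zero_le i)
      fun k _ hk => hq k (by omega)
    have w2 := Walk.of_seq (R := G.Step) (f := fun _ _ => 0) q hj.le
      fun k _ hk => hq k (by omega)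
    rw [← h3, hqn] at w2
    rw [hq0] at w1
    have := hmin _ _ _ (w1.append w2) hy
    omega
  obtain ⟨g, hg, hgq⟩ := exists_successor_of_injective (q := fun i => (q i).1)
    (fun i hi => (hq i hi).1) hinj
  simp only [hq0] at hgq
  refine ⟨g, hg, ?_⟩
  rintro ⟨⟨-, hnn⟩, -⟩
  have h3 := hnn n
  rw [WGame.energy_eq_of_step (by rw [hq0]) hq hgq le_rfl, hqn] at h3
  simp only [Nat.cast_zero, zero_add] at h3
  omega

theorem exists_successor_of_avg {s₀ : S} (h1 : ¬ HasLasso G.E (G.scaledWeight 1) s₀)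
    (h2 : ¬ HasLasso G.E (G.scaledWeight (-1)) s₀) {π : ℕ → S} (h0 : π 0 = s₀)
    (hπ : G.IsPlay π) {t : ℚ} (ht : ((t : ℝ) : EReal) < G.avgEnergySup π) :
    ∃ g : S → S, (∀ s, G.E s (g s)) ∧ (fun n => g^[n] s₀) ∉ G.ael t := by
  classical
  let P : ℕ → S × ℤ := fun i => (π i, G.energy π i)
  have hP0 : P 0 = (s₀, 0) := by simp [P, h0, WGame.energy_zero]
  have hP : ∀ i, G.Step (P i) (P (i + 1)) := WGame.step_of_isPlay hπ
  -- Each state occurs along `π` with a single level. Restricting the graph to the visited pairs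
  -- therefore makes it finite.
  have hfin : (Set.range P).Finite := by
    refine Set.Finite.of_finite_image (f := Prod.fst) (Set.toFinite _) ?_
    rintro _ ⟨i, rfl⟩ _ ⟨j, rfl⟩ hij
    rcases lt_trichotomy i j with h | h | h
    · exact snd_eq_of_not_hasLasso h1 h2 hP0 (fun k _ => hP k) h le_rfl hij
    · rw [h]
    · exact (snd_eq_of_not_hasLasso h1 h2 hP0 (fun k _ => hP k) h le_rfl hij.symm).symm
  let R : S × ℤ → S × ℤ → Prop := fun x y => G.Step x y ∧ x ∈ Set.range P ∧ y ∈ Set.range P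
  obtain ⟨K, hK⟩ := exists_bound_hasLasso (R := R) hfin.toFinset
    (fun x y h => by simpa using h.2) fun x y => -excess t x y
  obtain ⟨n, hn⟩ : ∃ n, K < ∑ i ∈ Finset.range n, ((G.energy π i : ℝ) - t) := by
    by_contra! hcon
    exact absurd (WGame.avgEnergySup_le hcon) (not_le.2 ht)
  have hw := Walk.of_seq (R := R) (f := fun x y => -excess t x y) P
    (Nat.zero_le n) fun i _ _ => ⟨hP i, ⟨i, rfl⟩, ⟨i + 1, rfl⟩⟩
  rw [hP0] at hw
  have hlasso := hK _ _ _ _ hw (by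
    rw [Finset.sum_neg_distrib, ← Finset.range_eq_Ico]
    exact neg_lt_neg hn)
  obtain ⟨q, a, b, hb, hq0, hq, hab, hinj, hs⟩ :=
    (hlasso.mono (R' := G.Step) fun x y h => h.1).exists_simple
  obtain ⟨g, hg, hgq⟩ := exists_successor_of_injective (q := fun i => (q i).1)
    (fun i hi => (hq i hi).1) fun i j hij hj heq =>
      hinj i j hij hj (snd_eq_of_not_hasLasso h1 h2 hq0 hq hij hj.le heq)
  simp only [hq0] at hgq
  refine ⟨g, hg, ?_⟩
  rintro ⟨-, -, havg⟩
  have hen : ∀ i ≤ a + b, G.energy (fun n => g^[n] s₀) i = (q i).2 := fun i hi =>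
    WGame.energy_eq_of_step (by rw [hq0]) hq hgq hi
  have hper : ∀ n, a ≤ n → g^[n + b] s₀ = g^[n] s₀ := fun n => iterate_add_period (by
    rw [hgq _ le_rfl, hgq _ (by omega), hab])
  have hper' : ∀ n, a ≤ n →
      G.energy (fun n => g^[n] s₀) (n + b) = G.energy (fun n => g^[n] s₀) n := by
    intro n hn
    rw [WGame.energy_add_period hper hn, hen _ le_rfl, hen a (by omega), hab]
    ring
  have hb' : (0 : ℝ) < b := by exact_mod_cast hb
  simp only [excess, Finset.sum_neg_distrib] at hs
  set Y := ∑ i ∈ Finset.Ico a (a + b), (((q i).2 : ℝ) - t) with hY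
  -- The mean level on the cycle is `t + Y / b`; this strict gap puts the average-energy above `t`.
  have hYpos : 0 < Y / b := div_pos (by linarith) hb'
  obtain ⟨C, hC⟩ := neg_le_sum_range_of_periodic
    (h := fun i => (G.energy (fun n => g^[n] s₀) i : ℝ) - (t + Y / b)) hb
    (fun i hi => by rw [hper' i hi]) (by
      have h3 : ∑ i ∈ Finset.Ico a (a + b),
          ((G.energy (fun n => g^[n] s₀) i : ℝ) - (t + Y / b)) =
          ∑ i ∈ Finset.Ico a (a + b), ((((q i).2 : ℝ) - t) - Y / b) :=
        Finset.sum_congr rfl fun i hi => by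
          rw [hen i (Finset.mem_Ico.1 hi).2.le]
          ring
      rw [h3, Finset.sum_sub_distrib, ← hY]
      simp only [Finset.sum_const, Nat.card_Ico, Nat.add_sub_cancel_left, nsmul_eq_mul]
      rw [mul_div_cancel₀ _ hb'.ne', sub_self])
  have := (WGame.le_avgEnergySup hC).trans havg
  rw [EReal.coe_le_coe_iff] at this
  linarith

/-- If some play violates the objective, then some positional play does. -/
theorem exists_successor_of_notMem_ael {s₀ : S} {π : ℕ → S} (h0 : π 0 = s₀) (hπ : G.IsPlay π)
    {t : ℚ} (h : π ∉ G.ael t) :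
    ∃ g : S → S, (∀ s, G.E s (g s)) ∧ (fun n => g^[n] s₀) ∉ G.ael t := by
  by_cases h1 : HasLasso G.E (G.scaledWeight 1) s₀
  · obtain ⟨g, hg, a, b, hp, hs⟩ := exists_successor_of_hasLasso h1
    exact ⟨g, hg, notMem_ael_of_negative_cycle t hp (by simpa using hs)⟩
  by_cases h2 : HasLasso G.E (G.scaledWeight (-1)) s₀
  · obtain ⟨g, hg, a, b, hp, hs⟩ := exists_successor_of_hasLasso h2
    exact ⟨g, hg, notMem_ael_of_positive_cycle t hp (by linarith)⟩
  by_cases h3 : ∃ N, G.energy π N < 0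
  · obtain ⟨N, hN⟩ := h3
    exact exists_successor_of_negative h1 h2 h0 hπ hN t
  · push Not at h3
    refine exists_successor_of_avg h1 h2 h0 hπ (not_le.1 fun h4 => h ?_)
    exact ⟨⟨hπ, fun n => by simpa using h3 n⟩, hπ, h4⟩

theorem memoryless_suffices (hG : G.IsOnePlayer) (s₀ : S) (t : ℚ)
    (h : ∃ σ : Strategy G Player.two, WinsTwo s₀ (G.ael t) σ) :
    ∃ σ : Strategy G Player.two, WinsTwo s₀ (G.ael t) σ ∧ σ.Memoryless := by
  obtain ⟨σ, hσ⟩ := h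
  rcases hG with hG | hG
  · obtain ⟨g, hg, hgt⟩ := exists_successor_of_notMem_ael (π := out s₀ (Classical.arbitrary _) σ)
      rfl (out_isPlay _ _ _) (hσ _)
    refine ⟨positional Player.two g hg, fun σ₁ => ?_, positional_memoryless _ _ _⟩
    have := (eq_out_iff s₀ σ₁ (positional Player.two g hg) (fun n => g^[n] s₀)).2
      ⟨fun n => by simpa only [Function.iterate_succ_apply'] using hg _, rfl,
        fun n hn => absurd hn (hG _), fun n _ => Function.iterate_succ_apply' g n s₀⟩
    rwa [← this]
  · obtain ⟨σ', hσ'⟩ := exists_memoryless G Player.two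
    exact ⟨σ', fun σ₁ => out_eq_of_ne_two hG s₀ σ₁ σ σ' ▸ hσ σ₁, hσ'⟩

end AvgEnergy

theorem mainTheorem10 :
    -- pseudo-polynomial memory suffices for player 1
    (∃ P : MvPolynomial (Fin 3) ℕ,
      ∀ (S : Type*) [Fintype S] (G : AvgEnergy.WGame S), G.IsOnePlayer → ∀ (s₀ : S) (t : ℚ),
        (∃ σ : AvgEnergy.Strategy G AvgEnergy.Player.one, AvgEnergy.WinsOne s₀ (G.ael t) σ) →
        ∃ σ : AvgEnergy.Strategy G AvgEnergy.Player.one, AvgEnergy.WinsOne s₀ (G.ael t) σ ∧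
          ∃ k : ℕ, k ≤ MvPolynomial.eval ![Fintype.card S, G.largestWeight, ⌈t⌉₊] P ∧
            σ.HasMemory k) ∧
    -- memory linear in the values of the weights and of the threshold is necessary for player 1
    (∀ U : ℕ, 1 ≤ U →
      ∃ (S : Type) (_ : Fintype S) (G : AvgEnergy.WGame S) (s₀ : S),
        (∀ s, G.owner s = AvgEnergy.Player.one) ∧ Fintype.card S = 2 ∧ G.largestWeight = U ∧
        (∃ σ : AvgEnergy.Strategy G AvgEnergy.Player.one,
          AvgEnergy.WinsOne s₀ (G.ael (U : ℚ)) σ) ∧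
        ∀ σ : AvgEnergy.Strategy G AvgEnergy.Player.one,
          AvgEnergy.WinsOne s₀ (G.ael (U : ℚ)) σ → ∀ k : ℕ, σ.HasMemory k → U + 1 ≤ k) ∧
    -- memoryless strategies suffice for player 2
    (∀ (S : Type*) [Fintype S] (G : AvgEnergy.WGame S), G.IsOnePlayer → ∀ (s₀ : S) (t : ℚ),
      (∃ σ : AvgEnergy.Strategy G AvgEnergy.Player.two, AvgEnergy.WinsTwo s₀ (G.ael t) σ) →
      ∃ σ : AvgEnergy.Strategy G AvgEnergy.Player.two, AvgEnergy.WinsTwo s₀ (G.ael t) σ ∧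
        σ.Memoryless) :=
  ⟨AvgEnergy.hasMemory_pseudopolynomial, AvgEnergy.memory_necessary,
    fun _ _ _ hG s₀ t h => AvgEnergy.memoryless_suffices hG s₀ t h⟩
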